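/- Conventions. All spaces are real. $|\cdot|$ is the absolute value on $\mathbb{R}$ and the Euclidean norm on $\mathbb{R}^d$ and on $\mathbb{R}^{d\times d}$ (Frobenius norm). For a Hilbert space $H$, a normed space $X$ and a bounded operator $S:H\to X$ put $$\|S\|_{\gamma(H,X)}=\sup\Big(\mathbb{E}\Big\|\sum_{n=1}^N\gamma_n S h_n\Big\|^2\Big)^{1/2}\in[0,\infty],$$ where the supremum is over all finite orthonormal systems $(h_n)_{n=1}^N$ in $H$ and the $\gamma_n$ are independent standard Gaussian variables; if $S=\sum_{n=1}^N h_n\otimes x_n$ with $(h_n)$ orthonormal, this equals $(\mathbb{E}\|\sum_{n=1}^N\gamma_n x_n\|^2)^{1/2}$. The space $\gamma(H,X)$ of $\gamma$-radonifying operators is the closure of the finite rank operators in this norm, and $\gamma(0,T;X):=\gamma(L^2(0,T),X)$. For an open set $\mathcal{O}\subseteq\mathbb{R}^d$, a finite-dimensional Euclidean space $E$ and $p\in[1,\infty)$, a function $u:(0,T)\times\mathcal{O}\to E$ is said to represent a bounded operator $S:L^2(0,T)\to L^p(\mathcal{O};E)$ if $u$ is measurable, $u(\cdot,x)\in L^2(0,T;E)$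 for almost all $x\in\mathcal{O}$, and for every $g\in L^2(0,T)$ one has $(Sg)(x)=\int_0^T g(t)u(t,x)\,dt$ for almost all $x\in\mathcal{O}$. For $\phi\in\gamma(0,T;W^{2,p}(\mathcal{O}))$, the operators $D\phi:=D\circ\phi$ and $D^2\phi:=D^2\circ\phi$ are the compositions with the weak gradient $D:W^{2,p}(\mathcal{O})\to L^p(\mathcal{O};\mathbb{R}^d)$ and the weak Hessian $D^2:W^{2,p}(\mathcal{O})\to L^p(\mathcal{O};\mathbb{R}^{d\times d})$, and $\phi$ is also regarded as an operator into $L^p(\mathcal{O})$. **Lemma 7.1.** For every $p\in[1,\infty)$ there is a constant $C\ge 0$, depending only on $p$, such that the following holds for every $d$, every open set $\mathcal{O}\subseteq\mathbb{R}^d$ and every $T\in(0,\infty)$. (i) For every $\phi\in\gamma(0,T;W^{2,p}(\mathcal{O}))$, each of the operators $\phi$, $D\phi$, $D^2\phi$ is represented by a function on $(0,T)\times\mathcal{O}$. (ii) Let $f:\mathbb{R}\times\mathbb{R}^d\times\mathbb{R}^{d\times d}\to\mathbb{R}$ satisfy $$|f(x,a,A)-f(y,b,B)|\le L_{f,1}|x-y|+L_{f,2}|a-b|+L_{f,3}|A-B|$$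 for all $x,y\in\mathbb{R}$, $a,b\in\mathbb{R}^d$, $A,B\in\mathbb{R}^{d\times d}$, with constants $L_{f,1},L_{f,2},L_{f,3}\ge 0$. Let $\phi_1,\phi_2\in\gamma(0,T;W^{2,p}(\mathcal{O}))$, and let $u_i,v_i,w_i$ be any functions representing $\phi_i,D\phi_i,D^2\phi_i$ ($i=1,2$). Then the function $f(u_1,v_1,w_1)-f(u_2,v_2,w_2)$ on $(0,T)\times\mathcal{O}$ represents an element of $\gamma(0,T;L^p(\mathcal{O}))$, denoted by $f(\phi_1,D\phi_1,D^2\phi_1)-f(\phi_2,D\phi_2,D^2\phi_2)$, and $$\begin{aligned}&\|f(\phi_1,D\phi_1,D^2\phi_1)-f(\phi_2,D\phi_2,D^2\phi_2)\|_{\gamma(0,T;L^p(\mathcal{O}))}\\&\quad\le C L_{f,1}\|\phi_1-\phi_2\|_{\gamma(0,T;L^p(\mathcal{O}))}+C L_{f,2}\|D\phi_1-D\phi_2\|_{\gamma(0,T;L^p(\mathcal{O};\mathbb{R}^d))}+C L_{f,3}\|D^2\phi_1-D^2\phi_2\|_{\gamma(0,T;L^p(\mathcal{O};\mathbb{R}^{d\times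 d}))}.\end{aligned}$$ -/

import Mathlib

open MeasureTheory ProbabilityTheory
open scoped ENNReal NNReal Distributions

noncomputable section

namespace GammaSpace

/-! ### Radonifying operators -/

section Radonifying

variable {H X : Type*} [NormedAddCommGroup H] [InnerProductSpace ℝ H]
  [NormedAddCommGroup X] [NormedSpace ℝ X]

/-- `(𝔼 ‖∑ γₙ xₙ‖²)^(1/2)` for independent standard real Gaussian variables `γₙ`, realised as the
coordinates of `Fin N → ℝ` under the product of `N` standard Gaussian laws. -/
def gaussianSum {N : ℕ} (x : Fin N → X) : ℝ≥0∞ :=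
  (∫⁻ c, ‖∑ n, c n • x n‖ₑ ^ 2 ∂(Measure.pi fun _ : Fin N => gaussianReal 0 1)) ^ (1 / 2 : ℝ)

/-- The `γ`-norm of an operator `T : H → X`, with values in `[0, ∞]`: the supremum of
`(𝔼 ‖∑ γₙ T hₙ‖²)^(1/2)` over all finite orthonormal systems `(hₙ)` in `H`. For a finite rank
operator `∑ hₙ ⊗ xₙ` with `(hₙ)` orthonormal it equals `(𝔼 ‖∑ γₙ xₙ‖²)^(1/2)`, see
`gammaNorm_sum_rankOne` below. -/
def gammaNorm (T : H →L[ℝ] X) : ℝ≥0∞ :=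
  ⨆ (N : ℕ) (h : Fin N → H) (_ : Orthonormal ℝ h), gaussianSum fun n => T (h n)

/-- An orthonormal system in a finite-dimensional Euclidean space turns the standard Gaussian law
into independent standard Gaussian coordinates. -/
theorem map_inner_stdGaussian {K : Type*} [NormedAddCommGroup K] [InnerProductSpace ℝ K]
    [FiniteDimensional ℝ K] [MeasurableSpace K] [BorelSpace K] {N : ℕ} {h : Fin N → K}
    (hh : Orthonormal ℝ h) :
    (stdGaussian K).map (fun z n => inner ℝ (h n) z) =
      Measure.pi fun _ : Fin N => gaussianReal 0 1 := by
  have hm : Measurable fun (z : K) (n : Fin N) => inner ℝ (h n) z :=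
    Continuous.measurable (by fun_prop)
  have key : ((stdGaussian K).map (fun z n => inner ℝ (h n) z)).map (WithLp.toLp 2) =
      (Measure.pi fun _ : Fin N => gaussianReal 0 1).map (WithLp.toLp 2) := by
    rw [map_pi_eq_stdGaussian, Measure.map_map (by fun_prop) hm]
    apply Measure.ext_of_charFun (E := EuclideanSpace ℝ (Fin N))
    ext t
    rw [charFun_stdGaussian, charFun_apply, integral_map
      (Measurable.aemeasurable (by fun_prop)) (Measurable.aestronglyMeasurable (by fun_prop))]
    have e : ∀ z : K, inner ℝ (WithLp.toLp 2 fun n => inner ℝ (h n) z) t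
        = inner ℝ z (∑ n, t n • h n) := by
      intro z
      simp [PiLp.inner_apply, inner_sum, real_inner_smul_right, real_inner_comm]
    have e2 : ‖∑ n, t n • h n‖ ^ 2 = ‖t‖ ^ 2 := by
      rw [← real_inner_self_eq_norm_sq, hh.inner_sum, EuclideanSpace.real_norm_sq_eq]
      simp [sq]
    simp only [Function.comp_apply, e]
    rw [← charFun_apply, charFun_stdGaussian, ← Complex.ofReal_pow, e2, Complex.ofReal_pow]
  have := congrArg (Measure.map (WithLp.ofLp : EuclideanSpace ℝ (Fin N) → Fin N → ℝ)) key
  rw [Measure.map_map (by fun_prop) (by fun_prop), Measure.map_map (by fun_prop) (by fun_prop)]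
    at this
  have e : Measure.map (WithLp.ofLp : EuclideanSpace ℝ (Fin N) → Fin N → ℝ)
      (Measure.map (WithLp.toLp 2) (Measure.pi fun _ : Fin N => gaussianReal 0 1)) =
      Measure.pi fun _ : Fin N => gaussianReal 0 1 := by
    rw [Measure.map_map (by fun_prop) (by fun_prop)]
    exact Measure.map_id
  exact this.trans e

/-- The `γ`-norm of the finite rank operator `∑ hₙ ⊗ xₙ` with `(hₙ)` orthonormal is
`(𝔼 ‖∑ γₙ xₙ‖²)^(1/2)`. -/
theorem gammaNorm_sum_rankOne {N : ℕ} {h : Fin N → H} (hh : Orthonormal ℝ h) (x : Fin N → X) :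
    gammaNorm (∑ n, (innerSL ℝ (h n)).smulRight (x n)) = gaussianSum x := by
  classical
  set T : H →L[ℝ] X := ∑ n, (innerSL ℝ (h n)).smulRight (x n) with hT
  have hTa : ∀ z, T z = ∑ n, inner ℝ (h n) z • x n := by
    intro z
    simp [hT]
  have hTh : ∀ n, T (h n) = x n := by
    intro n
    simp [hTa, orthonormal_iff_ite.1 hh]
  apply le_antisymm
  · refine iSup_le fun M => iSup_le fun g => iSup_le fun hg => ?_
    let K : Submodule ℝ H := Submodule.span ℝ (Set.range h ∪ Set.range g)
    have : FiniteDimensional ℝ K := FiniteDimensional.span_of_finite ℝ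
      ((Set.finite_range h).union (Set.finite_range g))
    let _ : MeasurableSpace K := borel K
    have : BorelSpace K := ⟨rfl⟩
    let h' : Fin N → K := fun n => ⟨h n, Submodule.subset_span (Or.inl ⟨n, rfl⟩)⟩
    let g' : Fin M → K := fun n => ⟨g n, Submodule.subset_span (Or.inr ⟨n, rfl⟩)⟩
    have hh' : Orthonormal ℝ h' := by
      rw [orthonormal_iff_ite] at hh ⊢
      exact hh
    have hg' : Orthonormal ℝ g' := by
      rw [orthonormal_iff_ite] at hg ⊢
      exact hg
    let G : Submodule ℝ K := Submodule.span ℝ (Set.range g')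
    let P : K →L[ℝ] K := G.starProjection
    let R : K ≃ₗᵢ[ℝ] K := G.reflection
    let T' : K →L[ℝ] X := T.comp K.subtypeL
    have hP : ∀ z, P z = ∑ n, inner ℝ (g' n) z • g' n := by
      intro z
      refine Submodule.eq_starProjection_of_mem_of_inner_eq_zero (K := G) ?_ ?_
      · exact Submodule.sum_mem _ fun n _ =>
          Submodule.smul_mem _ _ (Submodule.subset_span ⟨n, rfl⟩)
      · intro w hw
        induction hw using Submodule.span_induction with
        | mem w hw =>
          obtain ⟨m, rfl⟩ := hw
          rw [inner_sub_left, sum_inner]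
          simp only [real_inner_smul_left, orthonormal_iff_ite.1 hg']
          simp only [mul_ite, mul_one, mul_zero, Finset.sum_ite_eq', Finset.mem_univ, if_true]
          rw [real_inner_comm, sub_self]
        | zero => simp
        | add a b _ _ ha hb => rw [inner_add_right, ha, hb, add_zero]
        | smul r a _ ha => rw [real_inner_smul_right, ha, mul_zero]
    have hPR : ∀ z, P z = (2⁻¹ : ℝ) • (z + R z) := by
      intro z
      simp only [P, R, Submodule.reflection_apply]
      module
    have I1 : ∫⁻ c, ‖∑ n, c n • x n‖ₑ ^ 2 ∂(Measure.pi fun _ : Fin N => gaussianReal 0 1) =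
        ∫⁻ z, ‖T' z‖ₑ ^ 2 ∂(stdGaussian K) := by
      rw [← map_inner_stdGaussian hh', lintegral_map]
      · refine lintegral_congr fun z => ?_
        congr 2
        exact (hTa z).symm
      · exact Continuous.measurable (by fun_prop)
      · exact Continuous.measurable (by fun_prop)
    have I2 : ∫⁻ c, ‖∑ n, c n • T (g n)‖ₑ ^ 2 ∂(Measure.pi fun _ : Fin M => gaussianReal 0 1) =
        ∫⁻ z, ‖T' (P z)‖ₑ ^ 2 ∂(stdGaussian K) := by
      rw [← map_inner_stdGaussian hg', lintegral_map]
      · refine lintegral_congr fun z => ?_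
        rw [hP, map_sum]
        simp [T', g']
      · exact Continuous.measurable (by fun_prop)
      · exact Continuous.measurable (by fun_prop)
    have I3 : ∫⁻ z, ‖T' (R z)‖ₑ ^ 2 ∂(stdGaussian K) = ∫⁻ z, ‖T' z‖ₑ ^ 2 ∂(stdGaussian K) := by
      conv_rhs => rw [← stdGaussian_map R]
      rw [lintegral_map]
      · exact Continuous.measurable (by fun_prop)
      · exact Continuous.measurable (by fun_prop)
    have hpt : ∀ z, ‖T' (P z)‖ₑ ^ 2 ≤ 2⁻¹ * ‖T' z‖ₑ ^ 2 + 2⁻¹ * ‖T' (R z)‖ₑ ^ 2 := by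
      intro z
      have e : ∀ a : X, ‖a‖ₑ ^ 2 = ENNReal.ofReal (‖a‖ ^ 2) := fun a => by
        rw [← ofReal_norm, ENNReal.ofReal_pow (norm_nonneg a)]
      have e2 : (2⁻¹ : ℝ≥0∞) = ENNReal.ofReal 2⁻¹ := by
        rw [ENNReal.ofReal_inv_of_pos two_pos, ENNReal.ofReal_ofNat]
      rw [e, e, e, e2, ← ENNReal.ofReal_mul (by norm_num), ← ENNReal.ofReal_mul (by norm_num),
        ← ENNReal.ofReal_add (by positivity) (by positivity)]
      apply ENNReal.ofReal_le_ofReal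
      have h1 : ‖T' (P z)‖ ≤ 2⁻¹ * (‖T' z‖ + ‖T' (R z)‖) := by
        rw [hPR, map_smul, map_add, norm_smul]
        norm_num
        exact norm_add_le _ _
      nlinarith [norm_nonneg (T' (P z)), sq_nonneg (‖T' z‖ - ‖T' (R z)‖)]
    unfold gaussianSum
    gcongr 1
    rw [I1, I2]
    calc _ ≤ ∫⁻ z, (2⁻¹ * ‖T' z‖ₑ ^ 2 + 2⁻¹ * ‖T' (R z)‖ₑ ^ 2) ∂(stdGaussian K) :=
          lintegral_mono hpt
      _ = _ := by
          rw [lintegral_add_left ((Continuous.measurable (by fun_prop)).const_mul _),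
            lintegral_const_mul _ (Continuous.measurable (by fun_prop)),
            lintegral_const_mul _ (Continuous.measurable (by fun_prop)), I3, ← add_mul,
            ENNReal.inv_two_add_inv_two, one_mul]
  · refine le_trans (le_of_eq ?_) (le_iSup_of_le N (le_iSup_of_le h (le_iSup_of_le hh le_rfl)))
    simp only [hTh]

/-- `T ∈ γ(H, X)`: the operator `T` is a limit, in the `γ`-norm, of bounded operators of finite
rank. -/
def IsRadonifying (T : H →L[ℝ] X) : Prop :=
  ∀ ε : ℝ≥0∞, 0 < ε → ∃ S : H →L[ℝ] X,
    FiniteDimensional ℝ (LinearMap.range (S : H →ₗ[ℝ] X)) ∧ gammaNorm (T - S) ≤ ε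

end Radonifying

/-! ### The Sobolev space `W^{2,p}(O)` -/

/-- Euclidean space `ℝᵈ`. -/
abbrev Vec (d : ℕ) : Type := EuclideanSpace ℝ (Fin d)

/-- The space `ℝ^{d × d}` of matrices with the Euclidean (Frobenius) norm. -/
abbrev Mat (d : ℕ) : Type := EuclideanSpace ℝ (Fin d × Fin d)

variable {d : ℕ}

/-- `v` is the weak partial derivative `∂ᵢ u` on the open set `O`. -/
def IsWeakPartial (O : TopologicalSpace.Opens (Vec d)) (i : Fin d) (u v : Vec d → ℝ) : Prop :=
  ∀ ψ : 𝓓(O, ℝ), ∫ x in O, fderiv ℝ ψ x (EuclideanSpace.single i 1) * u x = -∫ x in O, ψ x * v x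

/-- The real space `L^p(O; F)` with respect to Lebesgue measure. -/
abbrev LpDom (O : TopologicalSpace.Opens (Vec d)) (F : Type) [NormedAddCommGroup F] (p : ℝ≥0∞) :
    Type :=
  Lp F p (volume.restrict (O : Set (Vec d)))

theorem integrable_test_mul {O : TopologicalSpace.Opens (Vec d)} {p : ℝ≥0∞} (hp : 1 ≤ p)
    {g u : Vec d → ℝ} (hg : Continuous g) (hg' : HasCompactSupport g)
    (hu : MemLp u p (volume.restrict (O : Set (Vec d)))) :
    Integrable (fun x => g x * u x) (volume.restrict (O : Set (Vec d))) :=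
  (hu.locallyIntegrable hp).integrable_smul_left_of_hasCompactSupport hg hg'

theorem IsWeakPartial.congr {O : TopologicalSpace.Opens (Vec d)} {i : Fin d}
    {u v u' v' : Vec d → ℝ} (h : IsWeakPartial O i u v)
    (hu : u' =ᵐ[volume.restrict (O : Set (Vec d))] u)
    (hv : v' =ᵐ[volume.restrict (O : Set (Vec d))] v) : IsWeakPartial O i u' v' := by
  intro ψ
  have h1 := integral_congr_ae (hu.mono fun x hx =>
    congrArg (fderiv ℝ ψ x (EuclideanSpace.single i 1) * ·) hx)
  have h2 := integral_congr_ae (hv.mono fun x hx => congrArg (ψ x * ·) hx)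
  exact h1.trans ((h ψ).trans (congrArg Neg.neg h2.symm))

theorem IsWeakPartial.add_smul {O : TopologicalSpace.Opens (Vec d)} {i : Fin d} {p : ℝ≥0∞}
    (hp : 1 ≤ p) {u v u' v' : Vec d → ℝ} (c : ℝ)
    (hu : MemLp u p (volume.restrict (O : Set (Vec d))))
    (hv : MemLp v p (volume.restrict (O : Set (Vec d))))
    (hu' : MemLp u' p (volume.restrict (O : Set (Vec d))))
    (hv' : MemLp v' p (volume.restrict (O : Set (Vec d))))
    (h : IsWeakPartial O i u v) (h' : IsWeakPartial O i u' v') :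
    IsWeakPartial O i (fun x => u x + c * u' x) (fun x => v x + c * v' x) := by
  intro ψ
  have hd : Continuous fun x => fderiv ℝ ψ x (EuclideanSpace.single i 1) :=
    (ψ.contDiff.continuous_fderiv (by simp)).clm_apply continuous_const
  have hd' : HasCompactSupport fun x => fderiv ℝ ψ x (EuclideanSpace.single i 1) :=
    ψ.hasCompactSupport.fderiv_apply ℝ _
  have e1 := integral_add (integrable_test_mul hp hd hd' hu)
    ((integrable_test_mul hp hd hd' hu').const_mul c)
  have e2 := integral_add (integrable_test_mul hp ψ.continuous ψ.hasCompactSupport hv)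
    ((integrable_test_mul hp ψ.continuous ψ.hasCompactSupport hv').const_mul c)
  rw [integral_const_mul] at e1 e2
  have f1 : ∀ x, fderiv ℝ ψ x (EuclideanSpace.single i 1) * (u x + c * u' x) =
      fderiv ℝ ψ x (EuclideanSpace.single i 1) * u x +
        c * (fderiv ℝ ψ x (EuclideanSpace.single i 1) * u' x) := fun x => by ring
  have f2 : ∀ x, ψ x * (v x + c * v' x) = ψ x * v x + c * (ψ x * v' x) := fun x => by ring
  simp only [f1, f2]
  rw [e1, e2, h ψ, h' ψ]
  ring

theorem IsWeakPartial.const_mul {O : TopologicalSpace.Opens (Vec d)} {i : Fin d}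
    {u v : Vec d → ℝ} (h : IsWeakPartial O i u v) (c : ℝ) :
    IsWeakPartial O i (fun x => c * u x) (fun x => c * v x) := by
  intro ψ
  have f1 : ∀ x, fderiv ℝ ψ x (EuclideanSpace.single i 1) * (c * u x) =
      c * (fderiv ℝ ψ x (EuclideanSpace.single i 1) * u x) := fun x => by ring
  have f2 : ∀ x, ψ x * (c * v x) = c * (ψ x * v x) := fun x => by ring
  simp only [f1, f2]
  rw [integral_const_mul, integral_const_mul, h ψ]
  ring

theorem memLp_coord {ι : Type} [Fintype ι] {O : TopologicalSpace.Opens (Vec d)} {p : ℝ≥0∞}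
    (v : LpDom O (EuclideanSpace ℝ ι) p) (i : ι) :
    MemLp (fun x => v x i) p (volume.restrict (O : Set (Vec d))) :=
  (EuclideanSpace.proj (𝕜 := ℝ) i).comp_memLp' (Lp.memLp v)

/-- The Sobolev space `W^{2,p}(O)`, realised as the space of triples `(u, Du, D²u)` in
`L^p(O) × L^p(O; ℝᵈ) × L^p(O; ℝ^{d × d})` such that `Du` and `D²u` are the weak gradient and the
weak Hessian of `u`, with the norm of the product (the maximum of the three `L^p`-norms, which is
equivalent to the other usual norms). -/
def Sobolev2 (O : TopologicalSpace.Opens (Vec d)) (p : ℝ≥0∞) [hp : Fact (1 ≤ p)] :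
    Submodule ℝ (LpDom O ℝ p × LpDom O (Vec d) p × LpDom O (Mat d) p) where
  carrier := {φ | (∀ i, IsWeakPartial O i φ.1 (fun x => φ.2.1 x i)) ∧
    ∀ i j, IsWeakPartial O j (fun x => φ.2.1 x i) (fun x => φ.2.2 x (i, j))}
  zero_mem' := by
    have h0 : ∀ {ι : Type} [Fintype ι] (k : ι),
        (fun x => ((0 : LpDom O (EuclideanSpace ℝ ι) p) : Vec d → EuclideanSpace ℝ ι) x k)
          =ᵐ[volume.restrict (O : Set (Vec d))] fun _ => (0 : ℝ) := fun k =>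
      (Lp.coeFn_zero (EuclideanSpace ℝ _) p _).mono fun x hx => 
        (congrArg (fun z : EuclideanSpace ℝ _ => z k) hx).trans rfl
    have hz : ∀ i, IsWeakPartial O i (fun _ => 0) (fun _ => 0) := fun i ψ => by simp
    exact ⟨fun i => (hz i).congr (Lp.coeFn_zero ℝ p _) (h0 i),
      fun i j => (hz j).congr (h0 i) (h0 (i, j))⟩
  add_mem' := by
    rintro φ φ' ⟨h1, h2⟩ ⟨h1', h2'⟩
    have ha : ∀ {ι : Type} [Fintype ι] (v v' : LpDom O (EuclideanSpace ℝ ι) p) (k : ι),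
        (fun x => (v + v' : LpDom O (EuclideanSpace ℝ ι) p) x k)
          =ᵐ[volume.restrict (O : Set (Vec d))] fun x => v x k + 1 * v' x k := fun v v' k =>
      (Lp.coeFn_add v v').mono fun x hx => by simp only [hx]; simp
    have hs : ∀ u u' : LpDom O ℝ p, (fun x => (u + u' : LpDom O ℝ p) x)
          =ᵐ[volume.restrict (O : Set (Vec d))] fun x => u x + 1 * u' x := fun u u' =>
      (Lp.coeFn_add u u').mono fun x hx => by simp only [hx]; simp
    exact ⟨fun i => ((h1 i).add_smul hp.out 1 (Lp.memLp _) (memLp_coord _ i) (Lp.memLp _)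
        (memLp_coord _ i) (h1' i)).congr (hs _ _) (ha _ _ i),
      fun i j => ((h2 i j).add_smul hp.out 1 (memLp_coord _ i) (memLp_coord _ (i, j))
        (memLp_coord _ i) (memLp_coord _ (i, j)) (h2' i j)).congr (ha _ _ i) (ha _ _ (i, j))⟩
  smul_mem' := by
    rintro c φ ⟨h1, h2⟩
    have ha : ∀ {ι : Type} [Fintype ι] (v : LpDom O (EuclideanSpace ℝ ι) p) (k : ι),
        (fun x => (c • v : LpDom O (EuclideanSpace ℝ ι) p) x k)
          =ᵐ[volume.restrict (O : Set (Vec d))] fun x => c * v x k := fun v k =>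
      (Lp.coeFn_smul c v).mono fun x hx => by simp [hx]
    have hs : ∀ u : LpDom O ℝ p, (fun x => (c • u : LpDom O ℝ p) x)
          =ᵐ[volume.restrict (O : Set (Vec d))] fun x => c * u x := fun u =>
      (Lp.coeFn_smul c u).mono fun x hx => by simp [hx]
    exact ⟨fun i => ((h1 i).const_mul c).congr (hs _) (ha _ i),
      fun i j => ((h2 i j).const_mul c).congr (ha _ i) (ha _ (i, j))⟩

/-- The operator `u ↦ u` from `W^{2,p}(O)` to `L^p(O)`. -/
def toLp (O : TopologicalSpace.Opens (Vec d)) (p : ℝ≥0∞) [Fact (1 ≤ p)] :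
    Sobolev2 O p →L[ℝ] LpDom O ℝ p :=
  (ContinuousLinearMap.fst ℝ _ _).comp (Sobolev2 O p).subtypeL

/-- The operator `D` from `W^{2,p}(O)` to `L^p(O; ℝᵈ)`. -/
def grad (O : TopologicalSpace.Opens (Vec d)) (p : ℝ≥0∞) [Fact (1 ≤ p)] :
    Sobolev2 O p →L[ℝ] LpDom O (Vec d) p :=
  ((ContinuousLinearMap.fst ℝ _ _).comp (ContinuousLinearMap.snd ℝ _ _)).comp
    (Sobolev2 O p).subtypeL

/-- The operator `D²` from `W^{2,p}(O)` to `L^p(O; ℝ^{d × d})`. -/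
def hess (O : TopologicalSpace.Opens (Vec d)) (p : ℝ≥0∞) [Fact (1 ≤ p)] :
    Sobolev2 O p →L[ℝ] LpDom O (Mat d) p :=
  ((ContinuousLinearMap.snd ℝ _ _).comp (ContinuousLinearMap.snd ℝ _ _)).comp
    (Sobolev2 O p).subtypeL

/-! ### Operators on `L²(0, T)` and functions on `(0, T) × O` -/

/-- The real Hilbert space `L²(0, T)`. -/
abbrev L2Time (T : ℝ) : Type := Lp ℝ 2 (volume.restrict (Set.Ioo 0 T))

/-- The operator `S : L²(0, T) → L^p(O; F)` is represented by the function `u` on `(0, T) × O`: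
`u` is measurable, `u(·, x) ∈ L²(0, T; F)` for almost all `x ∈ O`, and
`(S g)(x) = ∫₀ᵀ g(t) u(t, x) dt` for almost all `x ∈ O`, for each `g ∈ L²(0, T)`. -/
structure IsRepresentedBy {O : TopologicalSpace.Opens (Vec d)} {p : ℝ≥0∞} [Fact (1 ≤ p)]
    {F : Type} [NormedAddCommGroup F] [NormedSpace ℝ F] {T : ℝ}
    (S : L2Time T →L[ℝ] LpDom O F p) (u : ℝ → Vec d → F) : Prop where
  aestronglyMeasurable : AEStronglyMeasurable (Function.uncurry u)
    ((volume.restrict (Set.Ioo 0 T)).prod (volume.restrict (O : Set (Vec d))))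
  memLp_section : ∀ᵐ x ∂(volume.restrict (O : Set (Vec d))),
    MemLp (fun t => u t x) 2 (volume.restrict (Set.Ioo 0 T))
  apply_ae : ∀ g : L2Time T, ∀ᵐ x ∂(volume.restrict (O : Set (Vec d))),
    S g x = ∫ t in Set.Ioo 0 T, g t • u t x

end GammaSpace

end

/-!
The `γ`-norm of an operator `S : L²(0, T) → L^p(O; F)` that is represented by a function `u` is
comparable to the norm of the square function,
`‖ x ↦ ‖u(·, x)‖_{L²(0, T; F)} ‖_{L^p(O)}`, with constants that depend only on `p`
(`IsRepresentedBy.gammaNorm_le` and `IsRepresentedBy.eLpNorm_timeNorm_le`). In the square function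
norm the Lipschitz estimate is immediate: the pointwise bound
`|f(u₁, v₁, w₁) - f(u₂, v₂, w₂)| ≤ L₁ |u₁ - u₂| + L₂ |v₁ - v₂| + L₃ |w₁ - w₂|` passes through the
`L²`-norm in time and through the `L^p`-norm in space.

For a finite orthonormal system, the comparison is between a Gaussian sum in `L^p` and its square
function. At a fixed point `x` the Gaussian sum lives in the Euclidean space `F`, where all of its
moments are comparable with constants that do not depend on the dimension
(`lintegral_enorm_rpow_sum_smul_le`, `enorm_toLp_le_lintegral`). Exchanging the `L^p`-norm and the
Gaussian expectation is a matter of Minkowski's inequality (`gaussianSum_le_eLpNorm`) in one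
direction and of Hölder's inequality (`eLpNorm_le_gaussianSum`) in the other. Bessel's inequality,
and Fatou's lemma along a Hilbert basis, then replace finite orthonormal systems by `u` itself.

There remain the three statements on existence. An operator of finite `γ`-norm has square summable
values on a Hilbert basis at almost every point, which gives a measurable map from `O` to
`L²(0, T)` (`exists_hasKernel`), and such a map has a jointly measurable version
(`exists_jointly_measurable`); this is how `φ`, `Dφ` and `D²φ` are represented. Conversely a
function whose square function is in `L^p` represents an operator (`exists_operator_of_timeNorm`),
and that operator is `γ`-radonifying since, by dominated convergence, it is approximated by its
restrictions to the spans of finite parts of a Hilbert basis (`HasKernel.isRadonifying`).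
-/

noncomputable section

namespace GammaSpace

/-! ### Gaussian sums in a Euclidean space -/

/-- The law of `N` independent standard Gaussian variables. -/
abbrev gaussianPi (N : ℕ) : Measure (Fin N → ℝ) := Measure.pi fun _ => gaussianReal 0 1

/-- The absolute moment `𝔼 |γ|^r` of a standard Gaussian variable. -/
def gaussianMoment (r : ℝ) : ℝ≥0∞ := ∫⁻ x, ‖x‖ₑ ^ r ∂(gaussianReal 0 1)

theorem gaussianMoment_ne_top {r : ℝ} (hr : 0 < r) : gaussianMoment r ≠ ⊤ := by
  have h := (memLp_id_gaussianReal' (μ := 0) (v := 1) (ENNReal.ofReal r) (by simp)).eLpNorm_lt_top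
  have h2 := (eLpNorm_lt_top_iff_lintegral_rpow_enorm_lt_top (by simpa using hr) (by simp)).1 h
  rw [ENNReal.toReal_ofReal hr.le] at h2
  exact h2.ne

theorem gaussianMoment_two : gaussianMoment 2 = 1 := by
  have h := variance_id_gaussianReal (μ := 0) (v := 1)
  have hm : MemLp (id : ℝ → ℝ) 2 (gaussianReal 0 1) := memLp_id_gaussianReal' 2 (by simp)
  rw [variance_eq_integral (by fun_prop)] at h
  simp only [id_eq, integral_id_gaussianReal, sub_zero, NNReal.coe_one] at h
  have h2 : gaussianMoment 2 = ENNReal.ofReal (∫ x, x ^ 2 ∂(gaussianReal 0 1)) := by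
    have hi : Integrable (fun x : ℝ => x ^ 2) (gaussianReal 0 1) := hm.integrable_sq
    rw [ofReal_integral_eq_lintegral_ofReal hi (Filter.Eventually.of_forall fun x => sq_nonneg x)]
    refine lintegral_congr fun x => ?_
    rw [← sq_abs, ENNReal.ofReal_pow (abs_nonneg x), ← Real.norm_eq_abs, ofReal_norm]
    norm_num
  rw [h2, h, ENNReal.ofReal_one]

/-- A linear combination of independent standard Gaussian variables is Gaussian. -/
theorem map_sum_mul_gaussianPi {N : ℕ} (t : EuclideanSpace ℝ (Fin N)) :
    (gaussianPi N).map (fun c => ∑ n, c n * t n) =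
      (gaussianReal 0 1).map (fun x => ‖t‖ * x) := by
  have e : (fun c : Fin N → ℝ => ∑ n, c n * t n) = (innerSL ℝ t) ∘ (WithLp.toLp 2) := by
    ext c
    simp [PiLp.inner_apply]
  rw [e, ← Measure.map_map (by fun_prop) (by fun_prop), map_pi_eq_stdGaussian,
    IsGaussian.map_eq_gaussianReal, integral_strongDual_stdGaussian, variance_dual_stdGaussian,
    gaussianReal_map_const_mul]
  congr 1
  · simp
  · ext
    simp

theorem lintegral_sum_mul_gaussianPi {N : ℕ} (t : EuclideanSpace ℝ (Fin N)) {r : ℝ} (hr : 0 ≤ r) :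
    ∫⁻ c, ‖∑ n, c n * t n‖ₑ ^ r ∂(gaussianPi N) = ‖t‖ₑ ^ r * gaussianMoment r := by
  have hm : Measurable fun x : ℝ => ‖x‖ₑ ^ r := by fun_prop
  rw [← lintegral_map (f := fun x : ℝ => ‖x‖ₑ ^ r) (g := fun c : Fin N → ℝ => ∑ n, c n * t n) hm
    (by fun_prop), map_sum_mul_gaussianPi, lintegral_map hm (by fun_prop), gaussianMoment,
    ← lintegral_const_mul _ hm]
  refine lintegral_congr fun x => ?_
  rw [enorm_mul, ENNReal.mul_rpow_of_nonneg _ _ hr, enorm_norm]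

section Euclidean

variable {F : Type*} [NormedAddCommGroup F] [InnerProductSpace ℝ F]

theorem enorm_sq_eq_sum_coord {κ : Type*} [Fintype κ] (e : OrthonormalBasis κ ℝ F) (y : F) :
    ‖y‖ₑ ^ 2 = ∑ k, ‖inner ℝ (e k) y‖ₑ ^ 2 := by
  simp only [← ofReal_norm, ← ENNReal.ofReal_pow (norm_nonneg _)]
  rw [← ENNReal.ofReal_sum_of_nonneg fun _ _ => by positivity, e.sum_sq_norm_inner_right]

theorem enorm_toLp_sq {ι : Type*} [Fintype ι] {G : Type*} [SeminormedAddCommGroup G] (a : ι → G) :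
    ‖WithLp.toLp 2 a‖ₑ ^ 2 = ∑ n, ‖a n‖ₑ ^ 2 := by
  simp only [← ofReal_norm, ← ENNReal.ofReal_pow (norm_nonneg _)]
  rw [← ENNReal.ofReal_sum_of_nonneg fun _ _ => by positivity, PiLp.norm_sq_eq_of_L2]

theorem inner_sum_smul {N : ℕ} (y : F) (a : Fin N → F) (c : Fin N → ℝ) :
    inner ℝ y (∑ n, c n • a n) = ∑ n, c n * (WithLp.toLp 2 fun n => inner ℝ y (a n)) n := by
  simp [inner_sum, real_inner_smul_right]

theorem sum_enorm_toLp_inner_sq {N : ℕ} {κ : Type*} [Fintype κ] (e : OrthonormalBasis κ ℝ F)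
    (a : Fin N → F) :
    ∑ k, ‖WithLp.toLp 2 fun n => inner ℝ (e k) (a n)‖ₑ ^ 2 = ‖WithLp.toLp 2 a‖ₑ ^ 2 := by
  simp only [enorm_toLp_sq, enorm_sq_eq_sum_coord e]
  exact Finset.sum_comm

variable [FiniteDimensional ℝ F]

theorem lintegral_enorm_sq_sum_smul {N : ℕ} (a : Fin N → F) :
    ∫⁻ c, ‖∑ n, c n • a n‖ₑ ^ 2 ∂(gaussianPi N) = ‖WithLp.toLp 2 a‖ₑ ^ 2 := by
  let e := stdOrthonormalBasis ℝ F
  simp only [enorm_sq_eq_sum_coord e, inner_sum_smul]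
  rw [lintegral_finsetSum _ fun k _ => by fun_prop, ← sum_enorm_toLp_inner_sq e]
  refine Finset.sum_congr rfl fun k _ => ?_
  have h := lintegral_sum_mul_gaussianPi (WithLp.toLp 2 fun n => inner ℝ (e k) (a n)) zero_le_two
  simpa [gaussianMoment_two] using h

/-- Moments of a Gaussian vector in a Euclidean space, with the constant of the scalar case:
Minkowski's inequality in `L^{r/2}` is applied to the sum of the squared coordinates. -/
theorem lintegral_enorm_rpow_sum_smul_le {N : ℕ} (a : Fin N → F) {r : ℝ} (hr : 2 ≤ r) :
    ∫⁻ c, ‖∑ n, c n • a n‖ₑ ^ r ∂(gaussianPi N) ≤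
      gaussianMoment r * ‖WithLp.toLp 2 a‖ₑ ^ r := by
  let e := stdOrthonormalBasis ℝ F
  have hr0 : 0 < r := by linarith
  set q : ℝ≥0∞ := ENNReal.ofReal (r / 2) with hq
  have hq1 : 1 ≤ q := by
    rw [hq, ← ENNReal.ofReal_one]
    exact ENNReal.ofReal_le_ofReal (by linarith)
  have hq0 : q ≠ 0 := (zero_lt_one.trans_le hq1).ne'
  have hqt : q ≠ ⊤ := ENNReal.ofReal_ne_top
  have hqr : q.toReal = r / 2 := ENNReal.toReal_ofReal (by positivity)
  have hpow : ∀ y : ℝ≥0∞, (y ^ 2) ^ (r / 2) = y ^ r := fun y => by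
    rw [← ENNReal.rpow_natCast, ← ENNReal.rpow_mul]
    congr 1
    push_cast
    ring
  let Y : Fin (Module.finrank ℝ F) → (Fin N → ℝ) → ℝ≥0∞ := fun k c =>
    ‖∑ n, c n * (WithLp.toLp 2 fun n => inner ℝ (e k) (a n)) n‖ₑ ^ 2
  have hY : ∀ k, eLpNorm (Y k) q (gaussianPi N) =
      ‖WithLp.toLp 2 fun n => inner ℝ (e k) (a n)‖ₑ ^ 2 * gaussianMoment r ^ (2 / r) := fun k => by
    have hI : ∫⁻ c, Y k c ^ (r / 2) ∂(gaussianPi N) =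
        ‖WithLp.toLp 2 fun n => inner ℝ (e k) (a n)‖ₑ ^ r * gaussianMoment r := by
      simp only [Y, hpow]
      exact lintegral_sum_mul_gaussianPi (WithLp.toLp 2 fun n => inner ℝ (e k) (a n)) hr0.le
    rw [eLpNorm_eq_lintegral_rpow_enorm_toReal hq0 hqt, hqr]
    simp only [enorm_eq_self]
    rw [hI, ENNReal.mul_rpow_of_nonneg _ _ (by positivity),
      ← ENNReal.rpow_mul, one_div_div, mul_div_cancel₀ _ hr0.ne']
    norm_num
  have hsum : (fun c => ‖∑ n, c n • a n‖ₑ ^ 2) = ∑ k, Y k := by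
    ext c
    simp only [enorm_sq_eq_sum_coord e, inner_sum_smul, Finset.sum_apply, Y]
  have h1 := eLpNorm_sum_le (s := Finset.univ) (f := Y) (μ := gaussianPi N) (p := q)
    (fun k _ => Measurable.aestronglyMeasurable (by fun_prop)) hq1
  rw [← hsum, Finset.sum_congr rfl fun k _ => hY k, ← Finset.sum_mul, sum_enorm_toLp_inner_sq,
    eLpNorm_eq_lintegral_rpow_enorm_toReal hq0 hqt, hqr] at h1
  simp only [enorm_eq_self, hpow] at h1
  have h3 := ENNReal.rpow_le_rpow h1 (show 0 ≤ r / 2 by positivity)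
  rwa [← ENNReal.rpow_mul, ENNReal.mul_rpow_of_nonneg _ _ (by positivity), hpow,
    ← ENNReal.rpow_mul, show 1 / (r / 2) * (r / 2) = 1 by field_simp,
    show 2 / r * (r / 2) = 1 by field_simp, ENNReal.rpow_one, ENNReal.rpow_one, mul_comm] at h3

/-- The constant in Khintchine's inequality between the first and the second moment. -/
def khintchineConst : ℝ≥0 := 2 * NNReal.sqrt (2 * (gaussianMoment 4).toNNReal + 1)

/-- Khintchine's inequality between the first and the second moment. It follows from the bound on
the fourth moment, by integrating the pointwise inequality `y² ≤ l * y + y⁴ / l²`. -/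
theorem enorm_toLp_le_lintegral {N : ℕ} (a : Fin N → F) :
    ‖WithLp.toLp 2 a‖ₑ ≤ khintchineConst * ∫⁻ c, ‖∑ n, c n • a n‖ₑ ∂(gaussianPi N) := by
  set M : ℝ≥0 := (gaussianMoment 4).toNNReal
  have hM : (M : ℝ≥0∞) = gaussianMoment 4 :=
    ENNReal.coe_toNNReal (gaussianMoment_ne_top (by norm_num))
  set s : ℝ≥0 := ‖WithLp.toLp 2 a‖₊
  have hse : ‖WithLp.toLp 2 a‖ₑ = s := rfl
  rcases eq_or_ne s 0 with h0 | h0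
  · simp [hse, h0]
  have hspos : 0 < s := pos_iff_ne_zero.2 h0
  have hC : khintchineConst = 2 * NNReal.sqrt (2 * M + 1) := rfl
  set B : ℝ≥0 := NNReal.sqrt (2 * M + 1) with hB
  have hB2 : B ^ 2 = 2 * M + 1 := NNReal.sq_sqrt _
  have hBpos : 0 < B := by rw [hB]; simp
  -- with this `l`, the fourth moment absorbs only half of the second one
  set l : ℝ≥0 := B * s with hl
  have hlpos : 0 < l := mul_pos hBpos hspos
  have hpt : ∀ y : ℝ≥0, y ^ 2 ≤ l * y + (l ^ 2)⁻¹ * y ^ 4 := fun y => by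
    rcases le_total y l with h | h
    · calc y ^ 2 = y * y := sq y
        _ ≤ l * y := by gcongr
        _ ≤ _ := le_self_add
    · calc y ^ 2 = (l ^ 2)⁻¹ * (l ^ 2 * y ^ 2) := by field_simp
        _ ≤ (l ^ 2)⁻¹ * (y ^ 2 * y ^ 2) := by gcongr
        _ = (l ^ 2)⁻¹ * y ^ 4 := by ring
        _ ≤ _ := le_add_self
  have h2 := lintegral_enorm_sq_sum_smul a
  have h4 := lintegral_enorm_rpow_sum_smul_le a (r := 4) (by norm_num)
  set I := ∫⁻ c, ‖∑ n, c n • a n‖ₑ ∂(gaussianPi N)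
  have hmain : (s : ℝ≥0∞) ^ 2 ≤ l * I + ((l ^ 2)⁻¹ : ℝ≥0) * (M * (s : ℝ≥0∞) ^ 4) := by
    rw [← hse, ← h2]
    calc _ ≤ ∫⁻ c, (l * ‖∑ n, c n • a n‖ₑ +
          ((l ^ 2)⁻¹ : ℝ≥0) * ‖∑ n, c n • a n‖ₑ ^ (4 : ℝ)) ∂(gaussianPi N) := by
          refine lintegral_mono fun c => ?_
          have := hpt ‖∑ n, c n • a n‖₊
          rw [show (4 : ℝ) = ((4 : ℕ) : ℝ) by norm_num, ENNReal.rpow_natCast]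
          simp only [enorm_eq_nnnorm]
          exact_mod_cast this
      _ = l * I + ((l ^ 2)⁻¹ : ℝ≥0) * ∫⁻ c, ‖∑ n, c n • a n‖ₑ ^ (4 : ℝ) ∂(gaussianPi N) := by
          have hc : Continuous fun c : Fin N → ℝ => ∑ n, c n • a n := by fun_prop
          rw [lintegral_add_left (hc.enorm.measurable.const_mul _),
            lintegral_const_mul _ hc.enorm.measurable,
            lintegral_const_mul _ (hc.enorm.measurable.pow_const _)]
      _ ≤ _ := by
          gcongr
          refine h4.trans_eq ?_
          rw [← hM, ← ENNReal.rpow_natCast]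
          norm_num
  rw [hse, hC]
  rcases eq_or_ne I ⊤ with hIt | hIt
  · rw [hIt, ENNReal.mul_top]
    · exact le_top
    · simp [hBpos.ne']
  obtain ⟨J, hJ⟩ : ∃ J : ℝ≥0, (J : ℝ≥0∞) = I := ⟨_, ENNReal.coe_toNNReal hIt⟩
  rw [← hJ] at hmain ⊢
  norm_cast at hmain ⊢
  have h5 : (l ^ 2)⁻¹ * (M * s ^ 4) ≤ s ^ 2 / 2 := by
    have : (l ^ 2)⁻¹ * (M * s ^ 4) = M * s ^ 2 / (2 * M + 1) := by
      rw [← hB2, hl]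
      field_simp
    rw [this, div_le_div_iff₀ (by positivity) (by positivity)]
    calc M * s ^ 2 * 2 = s ^ 2 * (2 * M) := by ring
      _ ≤ s ^ 2 * (2 * M + 1) := by gcongr; exact le_self_add
  have h6 : s ^ 2 ≤ l * J + s ^ 2 / 2 := hmain.trans (by gcongr)
  have h7 : s * s ≤ s * (2 * B * J) := by
    rw [← NNReal.coe_le_coe] at h6 ⊢
    rw [hl] at h6
    push_cast at h6 ⊢
    nlinarith
  exact le_of_mul_le_mul_left h7 hspos

end Euclidean

/-- Minkowski's integral inequality, in the form of a comparison with a given function `τ`: if the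
`L^s(ρ)`-norm of `G ω x` in `ω` is at most a constant times `τ x`, then so it is after integration
in `x`. The proof is Jensen's inequality for the measure with density `τ`, and Tonelli's theorem. -/
theorem lintegral_rpow_lintegral_le {Ω α : Type*} [MeasurableSpace Ω] [MeasurableSpace α]
    {ρ : Measure Ω} {μ : Measure α} [SFinite ρ] [SFinite μ] {s : ℝ} (hs : 1 ≤ s)
    {G : Ω → α → ℝ≥0∞} (hG : Measurable (Function.uncurry G)) {τ : α → ℝ≥0∞} (hτ : Measurable τ)
    (hτt : ∀ x, τ x ≠ ⊤) (hτ0 : ∀ x, τ x = 0 → ∀ ω, G ω x = 0) {K : ℝ≥0∞}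
    (hK : ∀ x, ∫⁻ ω, G ω x ^ s ∂ρ ≤ K * τ x ^ s) :
    ∫⁻ ω, (∫⁻ x, G ω x ∂μ) ^ s ∂ρ ≤ K * (∫⁻ x, τ x ∂μ) ^ s := by
  have hs0 : 0 < s := by linarith
  have hGx : ∀ ω, Measurable (G ω) := fun ω => hG.of_uncurry_left
  have h1 : ∀ ω, (∫⁻ x, G ω x ∂μ) ^ s ≤
      (∫⁻ x, G ω x ^ s * τ x ^ (1 - s) ∂μ) * (∫⁻ x, τ x ∂μ) ^ (s - 1) := fun ω => by
    have hH := ENNReal.lintegral_mul_norm_pow_le (μ := μ)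
      (f := fun x => G ω x ^ s * τ x ^ (1 - s)) (g := τ) (p := 1 / s) (q := 1 - 1 / s)
      (((hGx ω).pow_const s).mul (hτ.pow_const _)).aemeasurable hτ.aemeasurable (by positivity)
      (by rw [sub_nonneg, div_le_one hs0]; exact hs) (by ring)
    -- where `τ` vanishes, the negative power of `τ` is infinite and `G` has to vanish as well
    have he : ∀ x, (G ω x ^ s * τ x ^ (1 - s)) ^ (1 / s) * τ x ^ (1 - 1 / s) = G ω x := fun x => by
      rcases eq_or_ne (τ x) 0 with h0 | h0
      · simp [hτ0 x h0 ω, hs0]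
      · rw [ENNReal.mul_rpow_of_nonneg _ _ (by positivity), ← ENNReal.rpow_mul,
          ← ENNReal.rpow_mul, mul_one_div_cancel hs0.ne', ENNReal.rpow_one, mul_assoc,
          ← ENNReal.rpow_add _ _ h0 (hτt x),
          show (1 - s) * (1 / s) + (1 - 1 / s) = 0 by field_simp; ring, ENNReal.rpow_zero, mul_one]
    simp only [he] at hH
    refine (ENNReal.rpow_le_rpow hH hs0.le).trans_eq ?_
    rw [ENNReal.mul_rpow_of_nonneg _ _ hs0.le, ← ENNReal.rpow_mul, ← ENNReal.rpow_mul,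
      one_div_mul_cancel hs0.ne', ENNReal.rpow_one]
    congr 2
    field_simp
  have hmeas : Measurable (Function.uncurry fun ω x => G ω x ^ s * τ x ^ (1 - s)) :=
    (hG.pow_const s).mul ((hτ.comp measurable_snd).pow_const _)
  calc _ ≤ ∫⁻ ω, (∫⁻ x, G ω x ^ s * τ x ^ (1 - s) ∂μ) * (∫⁻ x, τ x ∂μ) ^ (s - 1) ∂ρ :=
        lintegral_mono h1
    _ = (∫⁻ x, (∫⁻ ω, G ω x ^ s ∂ρ) * τ x ^ (1 - s) ∂μ) * (∫⁻ x, τ x ∂μ) ^ (s - 1) := by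
        rw [lintegral_mul_const _ (Measurable.lintegral_prod_right hmeas),
          lintegral_lintegral_swap hmeas.aemeasurable]
        congr 1
        refine lintegral_congr fun x => ?_
        exact lintegral_mul_const _ ((hG.of_uncurry_right (y := x)).pow_const s)
    _ ≤ (∫⁻ x, K * τ x ∂μ) * (∫⁻ x, τ x ∂μ) ^ (s - 1) := by
        refine mul_le_mul_left (lintegral_mono fun x => ?_) _
        refine (mul_le_mul_left (hK x) _).trans ?_
        rcases eq_or_ne (τ x) 0 with h0 | h0
        · simp [h0, hs0]
        · rw [mul_assoc, ← ENNReal.rpow_add _ _ h0 (hτt x)]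
          simp
    _ ≤ _ := by
        rw [lintegral_const_mul _ hτ, mul_assoc]
        gcongr
        rcases eq_or_ne (∫⁻ x, τ x ∂μ) 0 with h0 | h0
        · simp [h0]
        rcases eq_or_ne (∫⁻ x, τ x ∂μ) ⊤ with ht | ht
        · simp [ht, hs0]
        · nth_rw 1 [← ENNReal.rpow_one (∫⁻ x, τ x ∂μ)]
          rw [← ENNReal.rpow_add _ _ h0 ht]
          simp

/-! ### Gaussian sums in `L^p` and square functions -/

section SquareFunction

variable {α F : Type*} [MeasurableSpace α] {μ : Measure α} [NormedAddCommGroup F] {p : ℝ≥0∞}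

theorem gaussianSum_eq_eLpNorm {X : Type*} [NormedAddCommGroup X] [NormedSpace ℝ X] {N : ℕ}
    (x : Fin N → X) :
    gaussianSum x = eLpNorm (fun c => ∑ n, c n • x n) 2 (gaussianPi N) := by
  rw [eLpNorm_eq_lintegral_rpow_enorm_toReal (by norm_num) (by norm_num)]
  simp [gaussianSum]

theorem one_le_toReal (hp1 : 1 ≤ p) (hp : p ≠ ⊤) : 1 ≤ p.toReal := by
  rw [← ENNReal.toReal_one]
  exact ENNReal.toReal_mono hp hp1

theorem eLpNorm_rpow_toReal {E : Type*} [ENorm E] (hp1 : 1 ≤ p) (hp : p ≠ ⊤) (f : α → E) :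
    eLpNorm f p μ ^ p.toReal = ∫⁻ x, ‖f x‖ₑ ^ p.toReal ∂μ := by
  have hP := one_le_toReal hp1 hp
  rw [eLpNorm_eq_lintegral_rpow_enorm_toReal (zero_lt_one.trans_le hp1).ne' hp, ← ENNReal.rpow_mul,
    one_div_mul_cancel (by linarith), ENNReal.rpow_one]

theorem stronglyMeasurable_of_eval_piLp {ι : Type*} [Fintype ι] {f : α → PiLp 2 fun _ : ι => F}
    (hf : ∀ i, StronglyMeasurable fun x => f x i) : StronglyMeasurable f := by
  classical
  have e : f = fun x => WithLp.toLp 2 (∑ i, Pi.single i (f x i)) := by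
    ext x i
    simp
  rw [e]
  exact (PiLp.continuous_toLp 2 fun _ : ι => F).comp_stronglyMeasurable
    (Finset.stronglyMeasurable_fun_sum _ fun i _ =>
      (continuous_single i).comp_stronglyMeasurable (hf i))

theorem stronglyMeasurable_toLp_coeFn {N : ℕ} (f : Fin N → Lp F p μ) :
    StronglyMeasurable fun x => WithLp.toLp 2 fun n => f n x :=
  stronglyMeasurable_of_eval_piLp fun n => Lp.stronglyMeasurable (f n)

variable [InnerProductSpace ℝ F]

theorem coeFn_sum_smul {N : ℕ} (f : Fin N → Lp F p μ) (c : Fin N → ℝ) :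
    ⇑(∑ n, c n • f n) =ᵐ[μ] fun x => ∑ n, c n • f n x := by
  have h : ∀ᵐ x ∂μ, ∀ n, (c n • f n) x = c n • f n x :=
    ae_all_iff.2 fun n => Lp.coeFn_smul (c n) (f n)
  filter_upwards [Lp.coeFn_finsetSum Finset.univ fun n => c n • f n, h] with x hx h
  rw [hx]
  simp [h]

theorem stronglyMeasurable_uncurry_sum_smul {N : ℕ} (f : Fin N → Lp F p μ) :
    StronglyMeasurable (Function.uncurry fun (c : Fin N → ℝ) x => ∑ n, c n • f n x) := by
  have h : ∀ n, StronglyMeasurable fun z : (Fin N → ℝ) × α => z.1 n • f n z.2 := fun n =>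
    (Measurable.stronglyMeasurable (by fun_prop)).smul
      ((Lp.stronglyMeasurable (f n)).comp_measurable measurable_snd)
  exact Finset.stronglyMeasurable_fun_sum _ fun n _ => h n

variable [FiniteDimensional ℝ F] [SFinite μ] [hp1 : Fact (1 ≤ p)]

/-- A Gaussian sum in `L^p` is bounded by the `L^p`-norm of its square function. The larger of the
exponents `2` and `p` is used on the Gaussian side, so that Minkowski's inequality applies. -/
theorem gaussianSum_le_eLpNorm (hp : p ≠ ⊤) {N : ℕ} (f : Fin N → Lp F p μ) :
    gaussianSum f ≤ gaussianMoment (max 2 p.toReal) ^ (1 / max 2 p.toReal) *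
      eLpNorm (fun x => WithLp.toLp 2 fun n => f n x) p μ := by
  set P := p.toReal with hP
  have hP1 : 1 ≤ P := one_le_toReal hp1.out hp
  have hP0 : 0 < P := by linarith
  set r := max 2 P
  have hr2 : 2 ≤ r := le_max_left _ _
  have hr0 : 0 < r := by linarith
  have hPr : P * (r / P) = r := mul_div_cancel₀ _ hP0.ne'
  have hmink := lintegral_rpow_lintegral_le (ρ := gaussianPi N) (μ := μ) (s := r / P)
    (G := fun c x => ‖∑ n, c n • f n x‖ₑ ^ P) (τ := fun x => ‖WithLp.toLp 2 fun n => f n x‖ₑ ^ P)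
    (K := gaussianMoment r) (by rw [one_le_div hP0]; exact le_max_right _ _)
    ((stronglyMeasurable_uncurry_sum_smul f).enorm.pow_const P)
    ((stronglyMeasurable_toLp_coeFn f).enorm.pow_const P)
    (fun x => ENNReal.rpow_ne_top_of_nonneg hP0.le enorm_ne_top)
    (fun x hx c => by
      have h0 : (WithLp.toLp 2 fun n => f n x) = 0 := by simpa [hP0, hP0.not_gt] using hx
      have h1 : ∀ n, f n x = 0 := fun n => congrFun (congrArg WithLp.ofLp h0) n
      simp [h1, hP0])
    (fun x => by
      simp only [← ENNReal.rpow_mul, hPr]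
      exact lintegral_enorm_rpow_sum_smul_le _ hr2)
  simp only [← eLpNorm_rpow_toReal hp1.out hp, hP] at hmink
  rw [← hP] at hmink
  simp only [← ENNReal.rpow_mul, hPr] at hmink
  have hmain : ∫⁻ c, ‖∑ n, c n • f n‖ₑ ^ r ∂(gaussianPi N) ≤
      gaussianMoment r * eLpNorm (fun x => WithLp.toLp 2 fun n => f n x) p μ ^ r := by
    refine le_trans (le_of_eq (lintegral_congr fun c => ?_)) hmink
    rw [Lp.enorm_def, eLpNorm_congr_ae (coeFn_sum_smul f c)]
  have hcont : Continuous fun c : Fin N → ℝ => ∑ n, c n • f n := by fun_prop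
  rw [gaussianSum_eq_eLpNorm]
  refine (eLpNorm_le_eLpNorm_of_exponent_le (q := ENNReal.ofReal r) ?_
    hcont.aestronglyMeasurable).trans ?_
  · rw [← ENNReal.ofReal_ofNat]
    exact ENNReal.ofReal_le_ofReal hr2
  rw [eLpNorm_eq_lintegral_rpow_enorm_toReal (by simpa using hr0) (by simp),
    ENNReal.toReal_ofReal hr0.le]
  refine (ENNReal.rpow_le_rpow hmain (by positivity)).trans_eq ?_
  rw [ENNReal.mul_rpow_of_nonneg _ _ (by positivity), ← ENNReal.rpow_mul,
    mul_one_div_cancel hr0.ne', ENNReal.rpow_one]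

/-- The `L^p`-norm of a square function is bounded by the Gaussian sum: Khintchine's inequality
holds at each point, and Hölder's inequality against the power `p - 1` of the square function gives
the norms. -/
theorem eLpNorm_le_gaussianSum (hp : p ≠ ⊤) {N : ℕ} (f : Fin N → Lp F p μ) :
    eLpNorm (fun x => WithLp.toLp 2 fun n => f n x) p μ ≤ khintchineConst * gaussianSum f := by
  set P := p.toReal with hP
  have hP1 : 1 ≤ P := one_le_toReal hp1.out hp
  have hP0 : 0 < P := by linarith
  let σ : α → ℝ≥0∞ := fun x => ‖WithLp.toLp 2 fun n => f n x‖ₑ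
  have hσm : Measurable σ := (stronglyMeasurable_toLp_coeFn f).enorm
  have hYm : Measurable (Function.uncurry fun (c : Fin N → ℝ) x => ‖∑ n, c n • f n x‖ₑ) :=
    (stronglyMeasurable_uncurry_sum_smul f).enorm
  set A := eLpNorm (fun x => WithLp.toLp 2 fun n => f n x) p μ
  have hAP : A ^ P = ∫⁻ x, σ x ^ P ∂μ := eLpNorm_rpow_toReal hp1.out hp _
  have hAt : A ≠ ⊤ := by
    have : MemLp (fun x => WithLp.toLp 2 fun n => f n x) p μ :=
      MemLp.of_eval_piLp fun n => Lp.memLp (f n)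
    exact this.eLpNorm_ne_top
  have hsplit : ∀ x, σ x ^ P = σ x ^ (P - 1) * σ x := fun x => by
    conv_rhs => rw [← ENNReal.rpow_one (σ x), ← ENNReal.rpow_mul, one_mul]
    rw [← ENNReal.rpow_add_of_nonneg _ _ (by linarith) zero_le_one]
    ring_nf
  have hholder : ∀ c : Fin N → ℝ, ∫⁻ x, σ x ^ (P - 1) * ‖∑ n, c n • f n x‖ₑ ∂μ ≤
      A ^ (P - 1) * ‖∑ n, c n • f n‖ₑ := fun c => by
    have h := ENNReal.lintegral_mul_norm_pow_le (μ := μ) (f := fun x => σ x ^ P)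
      (g := fun x => ‖∑ n, c n • f n x‖ₑ ^ P) (p := 1 - 1 / P) (q := 1 / P)
      (hσm.pow_const P).aemeasurable ((hYm.of_uncurry_left (x := c)).pow_const P).aemeasurable
      (by rw [sub_nonneg, div_le_one hP0]; exact hP1) (by positivity) (by ring)
    rw [← hAP, ← eLpNorm_rpow_toReal hp1.out hp, ← hP, ← eLpNorm_congr_ae (coeFn_sum_smul f c),
      ← Lp.enorm_def] at h
    simp only [← ENNReal.rpow_mul, mul_one_div_cancel hP0.ne', ENNReal.rpow_one,
      show P * (1 - 1 / P) = P - 1 by field_simp] at h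
    exact h
  have hmain : A ^ P ≤ A ^ (P - 1) * (khintchineConst * gaussianSum f) := by
    have hm2 : Measurable (Function.uncurry fun (c : Fin N → ℝ) x =>
        σ x ^ (P - 1) * ‖∑ n, c n • f n x‖ₑ) :=
      ((hσm.comp measurable_snd).pow_const _).mul hYm
    have hcont : Continuous fun c : Fin N → ℝ => ∑ n, c n • f n := by fun_prop
    calc A ^ P = ∫⁻ x, σ x ^ (P - 1) * σ x ∂μ := by simp only [hAP, hsplit]
      _ ≤ ∫⁻ x, khintchineConst * ∫⁻ c, σ x ^ (P - 1) * ‖∑ n, c n • f n x‖ₑ ∂(gaussianPi N) ∂μ := by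
          refine lintegral_mono fun x => ?_
          rw [lintegral_const_mul _ (hYm.of_uncurry_right (y := x)), mul_left_comm]
          gcongr
          exact enorm_toLp_le_lintegral _
      _ = khintchineConst * ∫⁻ c, ∫⁻ x, σ x ^ (P - 1) * ‖∑ n, c n • f n x‖ₑ ∂μ ∂(gaussianPi N) := by
          rw [lintegral_const_mul' _ _ ENNReal.coe_ne_top,
            lintegral_lintegral_swap hm2.aemeasurable]
      _ ≤ khintchineConst * ∫⁻ c, A ^ (P - 1) * ‖∑ n, c n • f n‖ₑ ∂(gaussianPi N) := by
          gcongr with c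
          exact hholder c
      _ = A ^ (P - 1) * (khintchineConst * eLpNorm (fun c => ∑ n, c n • f n) 1 (gaussianPi N)) := by
          rw [lintegral_const_mul _ hcont.enorm.measurable, eLpNorm_one_eq_lintegral_enorm]
          ring
      _ ≤ _ := by
          rw [gaussianSum_eq_eLpNorm]
          gcongr
          exact eLpNorm_le_eLpNorm_of_exponent_le one_le_two hcont.aestronglyMeasurable
  rcases eq_or_ne A 0 with h0 | h0
  · simp [h0]
  have h1 : A ^ (P - 1) * A ≤ A ^ (P - 1) * (khintchineConst * gaussianSum f) := by
    refine le_trans (le_of_eq ?_) hmain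
    nth_rw 2 [← ENNReal.rpow_one A]
    rw [← ENNReal.rpow_add _ _ h0 hAt]
    ring_nf
  exact (ENNReal.mul_le_mul_iff_right (by simp [h0, hAt])
    (ENNReal.rpow_ne_top_of_nonneg (by linarith) hAt)).1 h1

end SquareFunction

/-! ### Elementary properties of the `γ`-norm -/

section GammaNorm

variable {H X Y : Type*} [NormedAddCommGroup H] [InnerProductSpace ℝ H]
  [NormedAddCommGroup X] [NormedSpace ℝ X] [NormedAddCommGroup Y] [NormedSpace ℝ Y]

theorem gaussianSum_add_le {N : ℕ} (x y : Fin N → X) :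
    gaussianSum (fun n => x n + y n) ≤ gaussianSum x + gaussianSum y := by
  have hc : ∀ z : Fin N → X, Continuous fun c : Fin N → ℝ => ∑ n, c n • z n := fun z => by fun_prop
  simp only [gaussianSum_eq_eLpNorm]
  refine le_trans (le_of_eq ?_) (eLpNorm_add_le (hc x).aestronglyMeasurable
    (hc y).aestronglyMeasurable one_le_two)
  congr 1
  ext c
  simp [Finset.sum_add_distrib]

theorem gaussianSum_clm_le {N : ℕ} (R : X →L[ℝ] Y) (x : Fin N → X) :
    gaussianSum (fun n => R (x n)) ≤ ENNReal.ofReal ‖R‖ * gaussianSum x := by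
  simp only [gaussianSum_eq_eLpNorm]
  refine eLpNorm_le_mul_eLpNorm_of_ae_le_mul (Filter.Eventually.of_forall fun c => ?_) 2
  simp only [← map_smul, ← map_sum]
  exact R.le_opNorm _

theorem gaussianSum_le_gammaNorm (S : H →L[ℝ] X) {N : ℕ} {h : Fin N → H} (hh : Orthonormal ℝ h) :
    gaussianSum (fun n => S (h n)) ≤ gammaNorm S :=
  le_iSup_of_le N (le_iSup_of_le h (le_iSup_of_le hh le_rfl))

theorem gammaNorm_le_of_gaussianSum_le {S : H →L[ℝ] X} {B : ℝ≥0∞}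
    (hB : ∀ (N : ℕ) (h : Fin N → H), Orthonormal ℝ h → gaussianSum (fun n => S (h n)) ≤ B) :
    gammaNorm S ≤ B :=
  iSup_le fun N => iSup_le fun h => iSup_le fun hh => hB N h hh

theorem gammaNorm_add_le (S S' : H →L[ℝ] X) : gammaNorm (S + S') ≤ gammaNorm S + gammaNorm S' :=
  gammaNorm_le_of_gaussianSum_le fun _ _ hh => (gaussianSum_add_le _ _).trans
    (add_le_add (gaussianSum_le_gammaNorm S hh) (gaussianSum_le_gammaNorm S' hh))

theorem gammaNorm_comp_le (R : X →L[ℝ] Y) (S : H →L[ℝ] X) :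
    gammaNorm (R.comp S) ≤ ENNReal.ofReal ‖R‖ * gammaNorm S :=
  gammaNorm_le_of_gaussianSum_le fun _ _ hh => (gaussianSum_clm_le R _).trans
    (mul_le_mul_right (gaussianSum_le_gammaNorm S hh) _)

theorem sum_enorm_inner_sq_le {N : ℕ} {h : Fin N → H} (hh : Orthonormal ℝ h) (v : H) :
    ∑ n, ‖inner ℝ v (h n)‖ₑ ^ 2 ≤ ‖v‖ₑ ^ 2 := by
  simp only [← ofReal_norm, ← ENNReal.ofReal_pow (norm_nonneg _)]
  rw [← ENNReal.ofReal_sum_of_nonneg fun _ _ => by positivity]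
  refine ENNReal.ofReal_le_ofReal ?_
  simpa only [real_inner_comm] using hh.sum_inner_products_le (s := Finset.univ) v

/-- Bessel's inequality for a finite family of vectors `v k`, summed over the family and over an
orthonormal system. -/
theorem enorm_toLp_le_of_inner {κ F : Type*} [Fintype κ] [NormedAddCommGroup F]
    [InnerProductSpace ℝ F] (e : OrthonormalBasis κ ℝ F) {N : ℕ} {h : Fin N → H}
    (hh : Orthonormal ℝ h) {a : Fin N → F} {v : PiLp 2 fun _ : κ => H}
    (hav : ∀ n k, inner ℝ (e k) (a n) = inner ℝ (v k) (h n)) :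
    ‖WithLp.toLp 2 a‖ₑ ≤ ‖v‖ₑ := by
  have hv : ‖v‖ₑ ^ 2 = ∑ k, ‖v k‖ₑ ^ 2 := enorm_toLp_sq (WithLp.ofLp v)
  rw [← ENNReal.pow_le_pow_left_iff two_ne_zero, hv, enorm_toLp_sq]
  simp only [enorm_sq_eq_sum_coord e, hav]
  rw [Finset.sum_comm]
  exact Finset.sum_le_sum fun k _ => sum_enorm_inner_sq_le hh (v k)

/-- An operator into a Euclidean space has finite `γ`-norm: there the Gaussian sums are
Hilbert–Schmidt norms, bounded through the vectors that represent the coordinates of `S`. -/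
theorem gammaNorm_ne_top_of_euclidean [CompleteSpace H] {F : Type*} [NormedAddCommGroup F]
    [InnerProductSpace ℝ F] [FiniteDimensional ℝ F] (S : H →L[ℝ] F) : gammaNorm S ≠ ⊤ := by
  let e := stdOrthonormalBasis ℝ F
  let v : PiLp 2 fun _ : Fin (Module.finrank ℝ F) => H :=
    WithLp.toLp 2 fun k => (InnerProductSpace.toDual ℝ H).symm ((innerSL ℝ (e k)).comp S)
  refine ne_top_of_le_ne_top (b := ‖v‖ₑ) enorm_ne_top (gammaNorm_le_of_gaussianSum_le
    fun N h hh => ?_)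
  have h1 : ‖WithLp.toLp 2 fun n => S (h n)‖ₑ ≤ ‖v‖ₑ := enorm_toLp_le_of_inner e hh fun n k => by
    simp only [v, InnerProductSpace.toDual_symm_apply]
    rfl
  refine le_trans (le_of_eq ?_) h1
  rw [gaussianSum, lintegral_enorm_sq_sum_smul, ← ENNReal.rpow_natCast, ← ENNReal.rpow_mul]
  norm_num

theorem gammaNorm_ne_top_of_finiteDimensional [CompleteSpace H] (S : H →L[ℝ] X)
    (hS : FiniteDimensional ℝ (LinearMap.range (S : H →ₗ[ℝ] X))) : gammaNorm S ≠ ⊤ := by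
  let L := toEuclidean (E := LinearMap.range (S : H →ₗ[ℝ] X))
  let S' : H →L[ℝ] LinearMap.range (S : H →ₗ[ℝ] X) := S.codRestrict _ fun x => ⟨x, rfl⟩
  let R := (LinearMap.range (S : H →ₗ[ℝ] X)).subtypeL.comp L.symm.toContinuousLinearMap
  have e : S = R.comp (L.toContinuousLinearMap.comp S') := by
    ext x
    change S x = (L.symm (L (S' x)) : X)
    rw [L.symm_apply_apply]
    rfl
  rw [e]
  exact ne_top_of_le_ne_top (ENNReal.mul_ne_top ENNReal.ofReal_ne_top
    (gammaNorm_ne_top_of_euclidean _)) (gammaNorm_comp_le R _)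

theorem IsRadonifying.gammaNorm_ne_top [CompleteSpace H] {S : H →L[ℝ] X} (hS : IsRadonifying S) :
    gammaNorm S ≠ ⊤ := by
  obtain ⟨S', h1, h2⟩ := hS 1 zero_lt_one
  rw [← sub_add_cancel S S']
  exact ne_top_of_le_ne_top (ENNReal.add_ne_top.2 ⟨ne_top_of_le_ne_top ENNReal.one_ne_top h2,
    gammaNorm_ne_top_of_finiteDimensional S' h1⟩) (gammaNorm_add_le _ _)

end GammaNorm

/-! ### Hilbert bases -/

section HilbertBases

variable {H ι : Type*} [NormedAddCommGroup H] [InnerProductSpace ℝ H]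

/-- Distinct members of an orthonormal family are at distance `√2`, so their balls of radius `1 / 2`
are disjoint. -/
theorem _root_.Orthonormal.countable [TopologicalSpace.SeparableSpace H] {v : ι → H}
    (hv : Orthonormal ℝ v) : Countable ι := by
  refine Pairwise.countable_of_isOpen_disjoint (s := fun i => Metric.ball (v i) (1 / 2)) ?_
    (fun _ => Metric.isOpen_ball) (fun i => ⟨v i, Metric.mem_ball_self (by norm_num)⟩)
  intro i j hij
  refine Metric.ball_disjoint_ball ?_
  have h : dist (v i) (v j) ^ 2 = 2 := by
    rw [dist_eq_norm, norm_sub_sq_real, hv.2 hij, hv.1, hv.1]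
    norm_num
  nlinarith [dist_nonneg (x := v i) (y := v j)]

/-- Parseval's identity, in `[0, ∞]`. -/
theorem enorm_sq_eq_tsum (b : HilbertBasis ι ℝ H) (v : H) :
    ‖v‖ₑ ^ 2 = ∑' i, ‖inner ℝ v (b i)‖ₑ ^ 2 := by
  have h := b.hasSum_inner_mul_inner v v
  have e : ∀ i, inner ℝ v (b i) * inner ℝ (b i) v = ‖inner ℝ v (b i)‖ ^ 2 := fun i => by
    rw [real_inner_comm v (b i), Real.norm_eq_abs, sq_abs, sq]
  simp only [e] at h
  simp only [← ofReal_norm, ← ENNReal.ofReal_pow (norm_nonneg _)]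
  rw [← ENNReal.ofReal_tsum_of_nonneg (fun _ => by positivity) h.summable, h.tsum_eq,
    real_inner_self_eq_norm_sq]

theorem norm_sub_sum_inner_smul_le {v : ι → H} (hv : Orthonormal ℝ v) (s : Finset ι) (x : H) :
    ‖x - ∑ i ∈ s, inner ℝ x (v i) • v i‖ ≤ ‖x‖ := by
  have h1 : inner ℝ x (∑ i ∈ s, inner ℝ x (v i) • v i) = ∑ i ∈ s, inner ℝ x (v i) ^ 2 := by
    simp [inner_sum, real_inner_smul_right, sq]
  have h2 : ‖∑ i ∈ s, inner ℝ x (v i) • v i‖ ^ 2 = ∑ i ∈ s, inner ℝ x (v i) ^ 2 := by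
    rw [← real_inner_self_eq_norm_sq, hv.inner_sum]
    simp [sq]
  have h3 : 0 ≤ ∑ i ∈ s, inner ℝ x (v i) ^ 2 := by positivity
  refine le_of_sq_le_sq ?_ (norm_nonneg _)
  rw [norm_sub_sq_real, h1, h2]
  linarith

theorem tendsto_sum_inner_smul (b : HilbertBasis ι ℝ H) (x : H) :
    Filter.Tendsto (fun s : Finset ι => ∑ i ∈ s, inner ℝ x (b i) • b i) Filter.atTop (nhds x) := by
  have h := b.hasSum_repr x
  simp only [b.repr_apply_apply, real_inner_comm] at h
  exact h

/-- Coefficients that are square summable are the coefficients of a vector. -/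
theorem exists_inner_eq (b : HilbertBasis ι ℝ H) {a : ι → ℝ} (ha : Summable fun i => ‖a i‖ ^ 2) :
    ∃ v : H, ∀ i, inner ℝ v (b i) = a i := by
  have hm : Memℓp a 2 := (memℓp_gen_iff (by norm_num)).2 (by simpa using ha)
  refine ⟨b.repr.symm ⟨a, hm⟩, fun i => ?_⟩
  rw [real_inner_comm, ← b.repr_apply_apply, LinearIsometryEquiv.apply_symm_apply]

theorem piLp_norm_le_of_forall {κ G : Type*} [Fintype κ] [NormedAddCommGroup G]
    {v w : PiLp 2 fun _ : κ => G} (h : ∀ k, ‖v k‖ ≤ ‖w k‖) : ‖v‖ ≤ ‖w‖ := by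
  rw [PiLp.norm_eq_of_L2, PiLp.norm_eq_of_L2]
  gcongr with k
  exact h k

end HilbertBases

/-! ### Operators into `L^p` given by vectors of a Hilbert space -/

section Kernel

variable {α F H κ : Type*} [MeasurableSpace α] {μ : Measure α} [NormedAddCommGroup F]
  [InnerProductSpace ℝ F] [NormedAddCommGroup H] [InnerProductSpace ℝ H] [Fintype κ] {p : ℝ≥0∞}
  [hp1 : Fact (1 ≤ p)]

/-- The operator `S : H → L^p(μ; F)` is given by the vectors `U x k` of `H`, for `x` in the base
space and `k` an index of the orthonormal basis `e` of `F`: the `k`-th coordinate of `S g` at `x` is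
`⟪U x k, g⟫`. For `H = L²(0, T)`, the vector `U x k` is the `k`-th coordinate of `t ↦ u t x`, where
`u` is a function that represents `S`. The families `(U x k)ₖ` are normed as elements of the Hilbert
sum, so that `‖U x‖` is the norm of `u(·, x)` in `L²(0, T; F)`. -/
def HasKernel (e : OrthonormalBasis κ ℝ F) (S : H →L[ℝ] Lp F p μ)
    (U : α → PiLp 2 fun _ : κ => H) : Prop :=
  ∀ g, ∀ᵐ x ∂μ, ∀ k, inner ℝ (e k) (S g x) = inner ℝ (U x k) g

variable {e : OrthonormalBasis κ ℝ F} {S : H →L[ℝ] Lp F p μ} {U : α → PiLp 2 fun _ : κ => H}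

theorem HasKernel.aestronglyMeasurable {ι : Type*} [Countable ι] (b : HilbertBasis ι ℝ H)
    (hU : HasKernel e S U) : AEStronglyMeasurable U μ := by
  have h1 : ∀ k i, AEStronglyMeasurable (fun x => inner ℝ (U x k) (b i)) μ := fun k i =>
    ((Lp.aestronglyMeasurable (S (b i))).const_inner (c := e k)).congr
      ((hU (b i)).mono fun x hx => hx k)
  have h2 : ∀ k, AEStronglyMeasurable (fun x => U x k) μ := fun k =>
    aestronglyMeasurable_of_tendsto_ae (Filter.atTop : Filter (Finset ι))
      (fun s => Finset.aestronglyMeasurable_fun_sum s fun i _ => (h1 k i).smul_const (b i))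
      (Filter.Eventually.of_forall fun x => tendsto_sum_inner_smul b (U x k))
  refine ⟨fun x => WithLp.toLp 2 fun k => (h2 k).mk _ x,
    stronglyMeasurable_of_eval_piLp fun k => (h2 k).stronglyMeasurable_mk, ?_⟩
  filter_upwards [ae_all_iff.2 fun k => (h2 k).ae_eq_mk] with x hx
  ext k
  exact hx k

/-- The constant in the bound of the `γ`-norm by the `L^p`-norm of the square function. -/
def upperConst (p : ℝ≥0∞) : ℝ≥0∞ :=
  gaussianMoment (max 2 p.toReal) ^ (1 / max 2 p.toReal)

theorem upperConst_ne_top (p : ℝ≥0∞) : upperConst p ≠ ⊤ := by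
  have h : 0 < max 2 p.toReal := lt_max_of_lt_left two_pos
  exact ENNReal.rpow_ne_top_of_nonneg (by positivity) (gaussianMoment_ne_top h)

variable [SFinite μ]

theorem HasKernel.gammaNorm_le (hp : p ≠ ⊤) (hU : HasKernel e S U) :
    gammaNorm S ≤ upperConst p * eLpNorm U p μ := by
  have : FiniteDimensional ℝ F := e.toBasis.finiteDimensional_of_finite
  refine gammaNorm_le_of_gaussianSum_le fun N h hh =>
    (gaussianSum_le_eLpNorm hp fun n => S (h n)).trans ?_
  refine mul_le_mul_right (eLpNorm_mono_enorm_ae ?_) _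
  filter_upwards [ae_all_iff.2 fun n => hU (h n)] with x hx
  exact enorm_toLp_le_of_inner e hh hx

/-- The `L^p`-norm of the square function of a Hilbert basis is bounded by the `γ`-norm, by
Fatou's lemma along the finite parts of the basis. -/
theorem lintegral_tsum_rpow_le [FiniteDimensional ℝ F] {ι : Type*} [Countable ι]
    (b : HilbertBasis ι ℝ H) (hp : p ≠ ⊤) (S : H →L[ℝ] Lp F p μ) :
    ∫⁻ x, (∑' i, ‖S (b i) x‖ₑ ^ 2) ^ (p.toReal / 2) ∂μ ≤
      (khintchineConst * gammaNorm S) ^ p.toReal := by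
  have hP := one_le_toReal hp1.out hp
  have hfin : ∀ s : Finset ι, ∫⁻ x, (∑ i ∈ s, ‖S (b i) x‖ₑ ^ 2) ^ (p.toReal / 2) ∂μ ≤
      (khintchineConst * gammaNorm S) ^ p.toReal := fun s => by
    have hh : Orthonormal ℝ fun n : Fin s.card => b (s.equivFin.symm n) :=
      b.orthonormal.comp _ (Subtype.val_injective.comp s.equivFin.symm.injective)
    have h1 := (eLpNorm_le_gaussianSum hp
      fun n : Fin s.card => S (b (s.equivFin.symm n))).trans
      (mul_le_mul_right (gaussianSum_le_gammaNorm S hh) _)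
    refine le_trans (le_of_eq ?_) (ENNReal.rpow_le_rpow h1 (by linarith : 0 ≤ p.toReal))
    rw [eLpNorm_rpow_toReal hp1.out hp]
    refine lintegral_congr fun x => ?_
    have h2 := enorm_toLp_sq fun n : Fin s.card => S (b (s.equivFin.symm n)) x
    rw [Equiv.sum_comp s.equivFin.symm fun i : s => ‖S (b i) x‖ₑ ^ 2,
      Finset.sum_coe_sort s fun i => ‖S (b i) x‖ₑ ^ 2] at h2
    rw [← h2, ← ENNReal.rpow_natCast, ← ENNReal.rpow_mul]
    congr 1
    push_cast
    ring
  have hlim : ∀ x, Filter.Tendsto (fun s : Finset ι => (∑ i ∈ s, ‖S (b i) x‖ₑ ^ 2) ^ (p.toReal / 2))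
      Filter.atTop (nhds ((∑' i, ‖S (b i) x‖ₑ ^ 2) ^ (p.toReal / 2))) := fun x =>
    (ENNReal.continuous_rpow_const.tendsto _).comp ENNReal.summable.hasSum
  calc _ = ∫⁻ x, Filter.liminf (fun s : Finset ι =>
        (∑ i ∈ s, ‖S (b i) x‖ₑ ^ 2) ^ (p.toReal / 2)) Filter.atTop ∂μ :=
        lintegral_congr fun x => (hlim x).liminf_eq.symm
    _ ≤ Filter.liminf (fun s : Finset ι =>
        ∫⁻ x, (∑ i ∈ s, ‖S (b i) x‖ₑ ^ 2) ^ (p.toReal / 2) ∂μ) Filter.atTop :=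
        lintegral_liminf_le' fun s => ((Finset.aemeasurable_fun_sum s fun i _ =>
          (Lp.aestronglyMeasurable (S (b i))).enorm.pow_const 2).pow_const _)
    _ ≤ _ := Filter.liminf_le_of_frequently_le' (Filter.Frequently.of_forall hfin)

/-- Parseval's identity for a finite family of vectors `v k`. -/
theorem enorm_sq_eq_tsum_of_inner {ι : Type*} (b : HilbertBasis ι ℝ H)
    (e : OrthonormalBasis κ ℝ F) {a : ι → F} {v : PiLp 2 fun _ : κ => H}
    (hav : ∀ i k, inner ℝ (e k) (a i) = inner ℝ (v k) (b i)) :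
    ‖v‖ₑ ^ 2 = ∑' i, ‖a i‖ₑ ^ 2 := by
  have hv : ‖v‖ₑ ^ 2 = ∑ k, ‖v k‖ₑ ^ 2 := enorm_toLp_sq (WithLp.ofLp v)
  rw [hv]
  simp only [enorm_sq_eq_sum_coord e, hav, enorm_sq_eq_tsum b]
  exact (Summable.tsum_finsetSum fun _ _ => ENNReal.summable).symm

theorem HasKernel.eLpNorm_le {ι : Type*} [Countable ι] (b : HilbertBasis ι ℝ H) (hp : p ≠ ⊤)
    (hU : HasKernel e S U) : eLpNorm U p μ ≤ khintchineConst * gammaNorm S := by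
  have : FiniteDimensional ℝ F := e.toBasis.finiteDimensional_of_finite
  have hP := one_le_toReal hp1.out hp
  refine (ENNReal.rpow_le_rpow_iff (by linarith : 0 < p.toReal)).1
    (le_trans (le_of_eq ?_) (lintegral_tsum_rpow_le b hp S))
  rw [eLpNorm_rpow_toReal hp1.out hp]
  refine lintegral_congr_ae ?_
  filter_upwards [ae_all_iff.2 fun i => hU (b i)] with x hx
  rw [← enorm_sq_eq_tsum_of_inner b e hx, ← ENNReal.rpow_natCast, ← ENNReal.rpow_mul]
  congr 1
  push_cast
  ring

/-- An operator into `L^p` with finite `γ`-norm is given by vectors of the Hilbert space: almost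
everywhere, the values of the operator on a Hilbert basis are square summable. -/
theorem exists_hasKernel {ι : Type*} [Countable ι] (b : HilbertBasis ι ℝ H)
    (e : OrthonormalBasis κ ℝ F) (hp : p ≠ ⊤) {S : H →L[ℝ] Lp F p μ} (hS : gammaNorm S ≠ ⊤) :
    ∃ U, HasKernel e S U := by
  have : FiniteDimensional ℝ F := e.toBasis.finiteDimensional_of_finite
  have hP := one_le_toReal hp1.out hp
  have hfin : ∀ᵐ x ∂μ, ∑' i, ‖S (b i) x‖ₑ ^ 2 < ⊤ := by
    have hm : AEMeasurable (fun x => (∑' i, ‖S (b i) x‖ₑ ^ 2) ^ (p.toReal / 2)) μ :=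
      (AEMeasurable.tsum fun i =>
        (Lp.aestronglyMeasurable (S (b i))).enorm.pow_const 2).pow_const _
    have h := ae_lt_top' hm (ne_top_of_le_ne_top (ENNReal.rpow_ne_top_of_nonneg
      (by linarith) (ENNReal.mul_ne_top ENNReal.coe_ne_top hS)) (lintegral_tsum_rpow_le b hp S))
    filter_upwards [h] with x hx
    exact (ENNReal.rpow_lt_top_iff_of_pos (by linarith)).1 hx
  have hex : ∀ x, ∃ v : PiLp 2 fun _ : κ => H, ∑' i, ‖S (b i) x‖ₑ ^ 2 < ⊤ →
      ∀ i k, inner ℝ (e k) (S (b i) x) = inner ℝ (v k) (b i) := fun x => by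
    by_cases hx : ∑' i, ‖S (b i) x‖ₑ ^ 2 < ⊤
    · have hsum : Summable fun i => ‖S (b i) x‖ ^ 2 := by
        have h := ENNReal.summable_toReal hx.ne
        simpa using h
      have hk : ∀ k, Summable fun i => ‖(inner ℝ (e k) (S (b i) x) : ℝ)‖ ^ 2 := fun k =>
        Summable.of_nonneg_of_le (fun _ => by positivity) (fun i => by
          gcongr
          simpa using norm_inner_le_norm (𝕜 := ℝ) (e k) (S (b i) x)) hsum
      choose v hv using fun k => exists_inner_eq b (hk k)
      exact ⟨WithLp.toLp 2 v, fun _ i k => (hv k i).symm⟩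
    · exact ⟨0, fun h => absurd h hx⟩
  choose U hU using hex
  refine ⟨U, fun g => ?_⟩
  have hlim : Filter.Tendsto (fun s : Finset ι => ∑ i ∈ s, inner ℝ g (b i) • S (b i)) Filter.atTop
      (nhds (S g)) := by
    have h := (S.continuous.tendsto g).comp (tendsto_sum_inner_smul b g)
    refine h.congr fun s => ?_
    simp
  -- the expansion of `S g` converges in `L^p`, hence almost everywhere along a sequence
  obtain ⟨s, hs, hae⟩ := (tendstoInMeasure_of_tendsto_Lp hlim).exists_seq_tendsto_ae'
  have hcoe : ∀ᵐ x ∂μ, ∀ s : Finset ι,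
      (∑ i ∈ s, inner ℝ g (b i) • S (b i)) x = ∑ i ∈ s, inner ℝ g (b i) • S (b i) x := by
    have h1 : ∀ᵐ x ∂μ, ∀ i,
        ((inner ℝ g (b i) : ℝ) • S (b i)) x = (inner ℝ g (b i) : ℝ) • S (b i) x :=
      ae_all_iff.2 fun i => Lp.coeFn_smul _ _
    refine ae_all_iff.2 fun s => ?_
    filter_upwards [h1, Lp.coeFn_fun_finsetSum s fun i => (inner ℝ g (b i) : ℝ) • S (b i)]
      with x hx hx'
    rw [hx']
    exact Finset.sum_congr rfl fun i _ => hx i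
  filter_upwards [hfin, hae, hcoe] with x hx hx' hx'' k
  have l1 : Filter.Tendsto (fun n => inner ℝ (e k) (∑ i ∈ s n, inner ℝ g (b i) • S (b i) x))
      Filter.atTop (nhds (inner ℝ (e k) (S g x))) := by
    simp only [hx''] at hx'
    exact tendsto_const_nhds.inner hx'
  have l2 : Filter.Tendsto (fun n => inner ℝ (U x k) (∑ i ∈ s n, inner ℝ g (b i) • b i))
      Filter.atTop (nhds (inner ℝ (U x k) g)) :=
    tendsto_const_nhds.inner ((tendsto_sum_inner_smul b g).comp hs)
  refine tendsto_nhds_unique l1 (l2.congr fun n => ?_)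
  simp only [inner_sum, real_inner_smul_right, hU x hx]

/-- An operator given by vectors `U x` with `‖U x‖` in `L^p` is `γ`-radonifying: it is approximated
by its restrictions to the span of finitely many vectors of a Hilbert basis. -/
theorem HasKernel.isRadonifying {ι : Type*} [Countable ι] (b : HilbertBasis ι ℝ H) (hp : p ≠ ⊤)
    (hU : HasKernel e S U) (hUp : eLpNorm U p μ ≠ ⊤) : IsRadonifying S := by
  have hP := one_le_toReal hp1.out hp
  let V : Finset ι → α → PiLp 2 fun _ : κ => H := fun s x =>
    WithLp.toLp 2 fun k => U x k - ∑ i ∈ s, inner ℝ (U x k) (b i) • b i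
  let A : Finset ι → H →L[ℝ] Lp F p μ := fun s => ∑ i ∈ s, (innerSL ℝ (b i)).smulRight (S (b i))
  have hA : ∀ s g, A s g = S (∑ i ∈ s, inner ℝ g (b i) • b i) := fun s g => by
    simp [A, real_inner_comm]
  have hV : ∀ s, HasKernel e (S - A s) (V s) := fun s g => by
    filter_upwards [hU (g - ∑ i ∈ s, inner ℝ g (b i) • b i)] with x hx k
    have e1 : (S - A s) g = S (g - ∑ i ∈ s, inner ℝ g (b i) • b i) := by
      rw [sub_apply, hA, map_sub]
    rw [e1, hx k]
    simp only [V, inner_sub_right, inner_sum, real_inner_smul_right, real_inner_comm g]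
    congr 1
    exact Finset.sum_congr rfl fun i _ => mul_comm _ _
  have hle : ∀ s x, ‖V s x‖ₑ ≤ ‖U x‖ₑ := fun s x => by
    rw [enorm_le_iff_norm_le]
    exact piLp_norm_le_of_forall fun k => norm_sub_sum_inner_smul_le b.orthonormal s (U x k)
  obtain ⟨s, hs⟩ := Filter.exists_seq_tendsto (Filter.atTop : Filter (Finset ι))
  have hlim : ∀ x, Filter.Tendsto (fun n => ‖V (s n) x‖ₑ ^ p.toReal) Filter.atTop (nhds 0) :=
    fun x => by
    have h1 : Filter.Tendsto (fun n => V (s n) x) Filter.atTop (nhds 0) := by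
      have h2 : Filter.Tendsto (fun n k => U x k - ∑ i ∈ s n, inner ℝ (U x k) (b i) • b i)
          Filter.atTop (nhds 0) := by
        refine tendsto_pi_nhds.2 fun k => ?_
        have h3 := ((tendsto_sum_inner_smul b (U x k)).comp hs).const_sub (U x k)
        rw [sub_self] at h3
        exact h3
      exact ((PiLp.continuous_toLp 2 fun _ : κ => H).tendsto 0).comp h2
    have h4 := (ENNReal.continuous_rpow_const (y := p.toReal)).tendsto _ |>.comp
      ((continuous_enorm.tendsto _).comp h1)
    rw [enorm_zero, ENNReal.zero_rpow_of_pos (by linarith)] at h4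
    exact h4
  have hconv : Filter.Tendsto (fun n => ∫⁻ x, ‖V (s n) x‖ₑ ^ p.toReal ∂μ) Filter.atTop
      (nhds 0) := by
    have h := tendsto_lintegral_of_dominated_convergence' (μ := μ)
      (F := fun n x => ‖V (s n) x‖ₑ ^ p.toReal) (f := fun _ => 0) (fun x => ‖U x‖ₑ ^ p.toReal)
      (fun n => ((hV (s n)).aestronglyMeasurable b).enorm.pow_const _)
      (fun n => Filter.Eventually.of_forall fun x =>
        ENNReal.rpow_le_rpow (hle _ x) (by linarith))
      (by
        rw [← eLpNorm_rpow_toReal hp1.out hp]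
        exact ENNReal.rpow_ne_top_of_nonneg (by linarith) hUp)
      (Filter.Eventually.of_forall hlim)
    rwa [lintegral_zero] at h
  have hconv2 : Filter.Tendsto (fun n => upperConst p * eLpNorm (V (s n)) p μ) Filter.atTop
      (nhds 0) := by
    have h := (ENNReal.continuous_rpow_const (y := 1 / p.toReal)).tendsto _ |>.comp hconv
    rw [ENNReal.zero_rpow_of_pos (by positivity)] at h
    have h2 := ENNReal.Tendsto.const_mul h (Or.inr (upperConst_ne_top p))
    rw [mul_zero] at h2
    refine h2.congr fun n => ?_
    rw [eLpNorm_eq_lintegral_rpow_enorm_toReal (zero_lt_one.trans_le hp1.out).ne' hp]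
    rfl
  intro ε hε
  obtain ⟨n, hn⟩ := (hconv2.eventually_le_const hε).exists
  refine ⟨A (s n), ?_, ((hV (s n)).gammaNorm_le hp).trans hn⟩
  have hspan : LinearMap.range (A (s n) : H →ₗ[ℝ] Lp F p μ) ≤
      Submodule.span ℝ ((fun i => S (b i)) '' (s n : Set ι)) := by
    rintro _ ⟨g, rfl⟩
    have e1 : (A (s n) : H →ₗ[ℝ] Lp F p μ) g = ∑ i ∈ s n, inner ℝ g (b i) • S (b i) := by
      simp [hA]
    rw [e1]
    exact Submodule.sum_mem _ fun i hi =>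
      Submodule.smul_mem _ _ (Submodule.subset_span ⟨i, hi, rfl⟩)
  have : FiniteDimensional ℝ (Submodule.span ℝ ((fun i => S (b i)) '' (s n : Set ι))) :=
    FiniteDimensional.span_of_finite ℝ ((s n).finite_toSet.image _)
  exact Submodule.finiteDimensional_of_le hspan

end Kernel

/-! ### Jointly measurable versions of `L²`-valued functions -/

instance fact_two_ne_top : Fact ((2 : ℝ≥0∞) ≠ ⊤) := ⟨ENNReal.ofNat_ne_top⟩

/-- If `fₙ` converges to `f` in `L^p` with geometric rate, then it converges almost everywhere. -/
theorem ae_tendsto_of_edist_le {β : Type*} [MeasurableSpace β] {ρ : Measure β} {p : ℝ≥0∞}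
    [hp1 : Fact (1 ≤ p)] {f : ℕ → Lp ℝ p ρ} {g : Lp ℝ p ρ}
    (hf : ∀ n, edist g (f n) < (2⁻¹ : ℝ≥0∞) ^ n) :
    ∀ᵐ t ∂ρ, Filter.Tendsto (fun n => f n t) Filter.atTop (nhds (g t)) := by
  have hpow : Filter.Tendsto (fun n : ℕ => (2⁻¹ : ℝ≥0∞) ^ n) Filter.atTop (nhds 0) :=
    ENNReal.tendsto_pow_atTop_nhds_zero_of_lt_one (by norm_num)
  have hlim : Filter.Tendsto f Filter.atTop (nhds g) := by
    rw [tendsto_iff_edist_tendsto_0]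
    refine tendsto_of_tendsto_of_tendsto_of_le_of_le tendsto_const_nhds hpow
      (fun _ => zero_le) fun n => ?_
    rw [edist_comm]
    exact (hf n).le
  have hB : ∑' n : ℕ, 2 * (2⁻¹ : ℝ≥0∞) ^ n ≠ ⊤ := by
    rw [ENNReal.tsum_mul_left, ENNReal.tsum_geometric]
    norm_num
  have hex := Lp.ae_tendsto_of_cauchy_eLpNorm (fun n => Lp.aestronglyMeasurable (f n)) hp1.out hB
    fun N n m hn hm => by
      have hmono : ∀ k, N ≤ k → (2⁻¹ : ℝ≥0∞) ^ k ≤ 2⁻¹ ^ N := fun k hk =>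
        pow_le_pow_right_of_le_one' (by norm_num) hk
      rw [← Lp.edist_def, two_mul]
      refine (edist_triangle_left (f n) (f m) g).trans_lt (ENNReal.add_lt_add ?_ ?_)
      · exact (hf n).trans_le (hmono n hn)
      · exact (hf m).trans_le (hmono m hm)
  -- a subsequence identifies the limit, which the rate shows to exist for the whole sequence
  obtain ⟨s, hs, hae⟩ := (tendstoInMeasure_of_tendsto_Lp hlim).exists_seq_tendsto_ae
  filter_upwards [hex, hae] with t ⟨l, hl⟩ ht
  rwa [← tendsto_nhds_unique (hl.comp hs.tendsto_atTop) ht]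

/-- A strongly measurable function with values in `L^p(ρ)` has a jointly measurable version. It is
approximated, uniformly with geometric rate, by functions with values in a countable dense set. -/
theorem exists_jointly_measurable {α β : Type*} [MeasurableSpace α] [MeasurableSpace β]
    {ρ : Measure β} {p : ℝ≥0∞} [hp1 : Fact (1 ≤ p)]
    [TopologicalSpace.SeparableSpace (Lp ℝ p ρ)] {U : α → Lp ℝ p ρ} (hU : StronglyMeasurable U) :
    ∃ u : β → α → ℝ, StronglyMeasurable (Function.uncurry u) ∧
      ∀ x, (fun t => u t x) =ᵐ[ρ] U x := by
  classical
  let d := TopologicalSpace.denseSeq (Lp ℝ p ρ)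
  have hd : ∀ (x : α) (j : ℕ), ∃ n, edist (U x) (d n) < (2⁻¹ : ℝ≥0∞) ^ j := fun x j => by
    obtain ⟨_, ⟨n, rfl⟩, hn⟩ := EMetric.mem_closure_iff.1
      (TopologicalSpace.denseRange_denseSeq (Lp ℝ p ρ) (U x)) ((2⁻¹ : ℝ≥0∞) ^ j)
      (ENNReal.pow_pos (by norm_num) j)
    exact ⟨n, hn⟩
  let m : ℕ → α → ℕ := fun j x => Nat.find (hd x j)
  have hm : ∀ j, Measurable (m j) := fun j => measurable_find _ fun k =>
    measurableSet_lt (hU.edist stronglyMeasurable_const).measurable measurable_const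
  let v : ℕ → β × α → ℝ := fun j z => d (m j z.2) z.1
  have hv : ∀ j, StronglyMeasurable (v j) := fun j => by
    have h1 : Measurable fun y : ℕ × β => d y.1 y.2 :=
      measurable_from_prod_countable_right fun n => (Lp.stronglyMeasurable (d n)).measurable
    have h2 : Measurable fun z : β × α => (m j z.2, z.1) :=
      ((hm j).comp measurable_snd).prodMk measurable_fst
    exact (h1.comp h2).stronglyMeasurable
  refine ⟨fun t x => Filter.limUnder Filter.atTop fun j => v j (t, x),
    StronglyMeasurable.limUnder (l := Filter.atTop) hv, fun x => ?_⟩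
  filter_upwards [ae_tendsto_of_edist_le (g := U x) (f := fun j => d (m j x))
    fun j => Nat.find_spec (hd x j)] with t ht
  exact ht.limUnder_eq

/-! ### Operators represented by functions on `(0, T) × O` -/

section Represented

variable {d : ℕ} {O : TopologicalSpace.Opens (Vec d)} {p : ℝ≥0∞} [hp1 : Fact (1 ≤ p)] {F : Type}
  [NormedAddCommGroup F] {T : ℝ}

/-- The norm of `u(·, x)` in `L²(0, T; F)`, as a function of `x`. -/
def timeNorm (T : ℝ) (u : ℝ → Vec d → F) (x : Vec d) : ℝ≥0∞ :=
  eLpNorm (fun t => u t x) 2 (volume.restrict (Set.Ioo 0 T))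

theorem aemeasurable_timeNorm {u : ℝ → Vec d → F}
    (hu : AEStronglyMeasurable (Function.uncurry u)
      ((volume.restrict (Set.Ioo 0 T)).prod (volume.restrict (O : Set (Vec d))))) :
    AEMeasurable (timeNorm T u) (volume.restrict (O : Set (Vec d))) := by
  have h : timeNorm T u = fun x =>
      (∫⁻ t in Set.Ioo 0 T, ‖Function.uncurry u (t, x)‖ₑ ^ (2 : ℝ)) ^ (1 / 2 : ℝ) := by
    ext x
    rw [timeNorm, eLpNorm_eq_lintegral_rpow_enorm_toReal two_ne_zero ENNReal.ofNat_ne_top]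
    simp
  rw [h]
  exact ((hu.enorm.pow_const 2).lintegral_prod_left').pow_const _

variable [InnerProductSpace ℝ F]

theorem integrable_smul_of_memLp (g : L2Time T) {v : ℝ → F}
    (hv : MemLp v 2 (volume.restrict (Set.Ioo 0 T))) :
    Integrable (fun t => g t • v t) (volume.restrict (Set.Ioo 0 T)) :=
  memLp_one_iff_integrable.1 (hv.smul (Lp.memLp g))

theorem IsRepresentedBy.sub {S S' : L2Time T →L[ℝ] LpDom O F p} {u u' : ℝ → Vec d → F}
    (hu : IsRepresentedBy S u) (hu' : IsRepresentedBy S' u') :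
    IsRepresentedBy (S - S') fun t x => u t x - u' t x where
  aestronglyMeasurable := hu.aestronglyMeasurable.sub hu'.aestronglyMeasurable
  memLp_section := by
    filter_upwards [hu.memLp_section, hu'.memLp_section] with x hx hx'
    exact hx.sub hx'
  apply_ae g := by
    filter_upwards [hu.memLp_section, hu'.memLp_section, hu.apply_ae g, hu'.apply_ae g,
      Lp.coeFn_sub (S g) (S' g)] with x hx hx' hg hg' hs
    simp only [smul_sub]
    rw [integral_sub (integrable_smul_of_memLp g hx) (integrable_smul_of_memLp g hx'), ← hg, ← hg']
    exact hs

/-- A measurable function `u` whose sections are square integrable, with square function in `L^p`,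
represents a bounded operator into `L^p`. -/
theorem exists_operator_of_timeNorm {u : ℝ → Vec d → F}
    (hm : AEStronglyMeasurable (Function.uncurry u)
      ((volume.restrict (Set.Ioo 0 T)).prod (volume.restrict (O : Set (Vec d)))))
    (hsec : ∀ᵐ x ∂(volume.restrict (O : Set (Vec d))),
      MemLp (fun t => u t x) 2 (volume.restrict (Set.Ioo 0 T)))
    (hfin : eLpNorm (timeNorm T u) p (volume.restrict (O : Set (Vec d))) ≠ ⊤) :
    ∃ S : L2Time T →L[ℝ] LpDom O F p, IsRepresentedBy S u := by
  let I : L2Time T → Vec d → F := fun g x => ∫ t in Set.Ioo 0 T, g t • u t x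
  have hIm : ∀ g, AEStronglyMeasurable (I g) (volume.restrict (O : Set (Vec d))) := fun g =>
    (((Lp.aestronglyMeasurable g).comp_fst).smul hm).prod_swap.integral_prod_right'
  have hIle : ∀ g, ∀ᵐ x ∂(volume.restrict (O : Set (Vec d))),
      ‖I g x‖ₑ ≤ (‖g‖₊ : ℝ≥0∞) * ‖timeNorm T u x‖ₑ := fun g => by
    filter_upwards [hsec] with x hx
    refine (enorm_integral_le_lintegral_enorm _).trans ?_
    rw [← eLpNorm_one_eq_lintegral_enorm]
    have hg : (‖g‖₊ : ℝ≥0∞) = eLpNorm g 2 (volume.restrict (Set.Ioo 0 T)) := Lp.enorm_def g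
    rw [hg, enorm_eq_self]
    exact eLpNorm_smul_le_mul_eLpNorm (p := 2) (q := 2) (r := 1) hx.aestronglyMeasurable
      (Lp.aestronglyMeasurable g)
  have hIp : ∀ g, eLpNorm (I g) p (volume.restrict (O : Set (Vec d))) ≤
      (‖g‖₊ : ℝ≥0∞) * eLpNorm (timeNorm T u) p (volume.restrict (O : Set (Vec d))) := fun g =>
    eLpNorm_le_nnreal_smul_eLpNorm_of_ae_le_mul' (hIle g) p
  have hI : ∀ g, MemLp (I g) p (volume.restrict (O : Set (Vec d))) := fun g =>
    ⟨hIm g, (hIp g).trans_lt (ENNReal.mul_lt_top ENNReal.coe_lt_top hfin.lt_top)⟩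
  let L : L2Time T →ₗ[ℝ] LpDom O F p :=
    { toFun := fun g => (hI g).toLp
      map_add' := fun g g' => by
        rw [← MemLp.toLp_add, MemLp.toLp_eq_toLp_iff]
        filter_upwards [hsec] with x hx
        have h := integral_add (integrable_smul_of_memLp g hx) (integrable_smul_of_memLp g' hx)
        refine Eq.trans (integral_congr_ae ?_) h
        filter_upwards [Lp.coeFn_add g g'] with t ht
        rw [ht, Pi.add_apply, add_smul]
      map_smul' := fun c g => by
        rw [RingHom.id_apply, ← MemLp.toLp_const_smul, MemLp.toLp_eq_toLp_iff]
        refine Filter.Eventually.of_forall fun x => ?_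
        refine Eq.trans (integral_congr_ae ?_) (integral_smul c _)
        filter_upwards [Lp.coeFn_smul c g] with t ht
        rw [ht, Pi.smul_apply, smul_assoc] }
  refine ⟨L.mkContinuous
    (eLpNorm (timeNorm T u) p (volume.restrict (O : Set (Vec d)))).toReal fun g => ?_, hm, hsec,
    fun g => (hI g).coeFn_toLp⟩
  have h := ENNReal.toReal_mono (ENNReal.mul_ne_top ENNReal.coe_ne_top hfin) (hIp g)
  rw [ENNReal.toReal_mul, mul_comm, ← Lp.norm_toLp _ (hI g)] at h
  exact h

variable [FiniteDimensional ℝ F]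

/-- The coordinates of `u(·, x)`, as elements of `L²(0, T)`; a coordinate that is not square
integrable is replaced by `0`. -/
def sectionVec (T : ℝ) (u : ℝ → Vec d → F) (x : Vec d) :
    PiLp 2 fun _ : Fin (Module.finrank ℝ F) => L2Time T :=
  open Classical in
  WithLp.toLp 2 fun k =>
    if h : MemLp (fun t => (inner ℝ (stdOrthonormalBasis ℝ F k) (u t x) : ℝ)) 2
      (volume.restrict (Set.Ioo 0 T)) then h.toLp else 0

theorem inner_integral_smul (g : L2Time T) {v : ℝ → F}
    (hv : MemLp v 2 (volume.restrict (Set.Ioo 0 T))) (y : F) {w : L2Time T}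
    (hw : ∀ᵐ t ∂(volume.restrict (Set.Ioo 0 T)), w t = inner ℝ y (v t)) :
    inner ℝ y (∫ t in Set.Ioo 0 T, g t • v t) = inner ℝ w g := by
  rw [← integral_inner (integrable_smul_of_memLp g hv), L2.inner_def]
  refine integral_congr_ae ?_
  filter_upwards [hw] with t ht
  rw [real_inner_smul_right, ht]
  simp

theorem enorm_sectionVec {u : ℝ → Vec d → F} {x : Vec d}
    (hx : MemLp (fun t => u t x) 2 (volume.restrict (Set.Ioo 0 T))) :
    ‖sectionVec T u x‖ₑ = timeNorm T u x := by
  have hsq : ∀ {E : Type} [NormedAddCommGroup E] (f : ℝ → E),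
      eLpNorm f 2 (volume.restrict (Set.Ioo 0 T)) ^ 2 =
        ∫⁻ t in Set.Ioo 0 T, ‖f t‖ₑ ^ 2 := fun f => by
    have h := eLpNorm_rpow_toReal (p := 2) (μ := volume.restrict (Set.Ioo 0 T)) one_le_two
      ENNReal.ofNat_ne_top f
    simpa using h
  have hm : ∀ k, MemLp (fun t => (inner ℝ (stdOrthonormalBasis ℝ F k) (u t x) : ℝ)) 2
      (volume.restrict (Set.Ioo 0 T)) := fun k => hx.const_inner _
  have h : ‖sectionVec T u x‖ₑ ^ 2 = timeNorm T u x ^ 2 := by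
    simp only [sectionVec, dif_pos (hm _), enorm_toLp_sq, Lp.enorm_toLp, hsq, timeNorm,
      enorm_sq_eq_sum_coord (stdOrthonormalBasis ℝ F)]
    exact (lintegral_finsetSum' _ fun k _ => (hm k).aestronglyMeasurable.enorm.pow_const 2).symm
  exact le_antisymm ((ENNReal.pow_le_pow_left_iff two_ne_zero).1 h.le)
    ((ENNReal.pow_le_pow_left_iff two_ne_zero).1 h.ge)

theorem IsRepresentedBy.hasKernel {S : L2Time T →L[ℝ] LpDom O F p} {u : ℝ → Vec d → F}
    (hu : IsRepresentedBy S u) : HasKernel (stdOrthonormalBasis ℝ F) S (sectionVec T u) := by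
  intro g
  filter_upwards [hu.memLp_section, hu.apply_ae g] with x hx hg k
  rw [hg]
  refine inner_integral_smul g hx _ ?_
  simp only [sectionVec, dif_pos (hx.const_inner _)]
  exact MemLp.coeFn_toLp _

theorem IsRepresentedBy.eLpNorm_sectionVec {S : L2Time T →L[ℝ] LpDom O F p} {u : ℝ → Vec d → F}
    (hu : IsRepresentedBy S u) :
    eLpNorm (sectionVec T u) p (volume.restrict (O : Set (Vec d))) =
      eLpNorm (timeNorm T u) p (volume.restrict (O : Set (Vec d))) :=
  eLpNorm_congr_enorm_ae (hu.memLp_section.mono fun x hx => by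
    rw [enorm_sectionVec hx, enorm_eq_self])

theorem exists_hilbertBasis_time (T : ℝ) :
    ∃ w : Set (L2Time T), Countable w ∧ Nonempty (HilbertBasis w ℝ (L2Time T)) := by
  obtain ⟨w, b, -⟩ := exists_hilbertBasis ℝ (L2Time T)
  exact ⟨w, b.orthonormal.countable, ⟨b⟩⟩

/-- The `γ`-norm of a represented operator is bounded by its square function. -/
theorem IsRepresentedBy.gammaNorm_le (hp : p ≠ ⊤) {S : L2Time T →L[ℝ] LpDom O F p}
    {u : ℝ → Vec d → F} (hu : IsRepresentedBy S u) :
    gammaNorm S ≤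
      upperConst p * eLpNorm (timeNorm T u) p (volume.restrict (O : Set (Vec d))) :=
  (hu.hasKernel.gammaNorm_le hp).trans_eq (by rw [hu.eLpNorm_sectionVec])

/-- The square function of a represented operator is bounded by its `γ`-norm. -/
theorem IsRepresentedBy.eLpNorm_timeNorm_le (hp : p ≠ ⊤) {S : L2Time T →L[ℝ] LpDom O F p}
    {u : ℝ → Vec d → F} (hu : IsRepresentedBy S u) :
    eLpNorm (timeNorm T u) p (volume.restrict (O : Set (Vec d))) ≤
      khintchineConst * gammaNorm S := by
  obtain ⟨w, _, ⟨b⟩⟩ := exists_hilbertBasis_time T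
  rw [← hu.eLpNorm_sectionVec]
  exact hu.hasKernel.eLpNorm_le b hp

theorem IsRepresentedBy.isRadonifying (hp : p ≠ ⊤) {S : L2Time T →L[ℝ] LpDom O F p}
    {u : ℝ → Vec d → F} (hu : IsRepresentedBy S u)
    (hfin : eLpNorm (timeNorm T u) p (volume.restrict (O : Set (Vec d))) ≠ ⊤) :
    IsRadonifying S := by
  obtain ⟨w, _, ⟨b⟩⟩ := exists_hilbertBasis_time T
  exact hu.hasKernel.isRadonifying b hp (by rwa [hu.eLpNorm_sectionVec])

/-- An operator into `L^p` with finite `γ`-norm is represented by a function. -/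
theorem exists_isRepresentedBy (hp : p ≠ ⊤) {S : L2Time T →L[ℝ] LpDom O F p}
    (hS : gammaNorm S ≠ ⊤) : ∃ u, IsRepresentedBy S u := by
  obtain ⟨w, _, ⟨b⟩⟩ := exists_hilbertBasis_time T
  let e := stdOrthonormalBasis ℝ F
  obtain ⟨U, hU⟩ := exists_hasKernel b e hp hS
  have hUm := hU.aestronglyMeasurable b
  have hmk : ∀ k, StronglyMeasurable fun x => hUm.mk U x k := fun k =>
    (PiLp.proj (𝕜 := ℝ) 2 (fun _ => L2Time T) k).continuous.comp_stronglyMeasurable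
      hUm.stronglyMeasurable_mk
  choose v hvm hv using fun k => exists_jointly_measurable (hmk k)
  have hcoord : ∀ t x k, inner ℝ (e k) (∑ j, v j t x • e j) = v k t x := fun t x k => by
    rw [inner_sum]
    simp [real_inner_smul_right, orthonormal_iff_ite.1 e.orthonormal]
  have hmem : ∀ x, MemLp (fun t => ∑ j, v j t x • e j) 2 (volume.restrict (Set.Ioo 0 T)) :=
    fun x => memLp_finsetSum _ fun j _ =>
      (ContinuousLinearMap.toSpanSingleton ℝ (e j)).comp_memLp'
        ((memLp_congr_ae (hv j x)).2 (Lp.memLp _))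
  refine ⟨fun t x => ∑ j, v j t x • e j, ?_, Filter.Eventually.of_forall hmem, fun g => ?_⟩
  · exact (Finset.stronglyMeasurable_fun_sum _ fun j _ =>
      (hvm j).smul_const (e j)).aestronglyMeasurable
  · filter_upwards [hU g, hUm.ae_eq_mk] with x hx hx'
    refine e.repr.injective (PiLp.ext fun k => ?_)
    rw [e.repr_apply_apply, e.repr_apply_apply, hx k, hx']
    refine (inner_integral_smul g (hmem x) (e k) ?_).symm
    filter_upwards [hv k x] with t ht
    rw [hcoord, ht]

end Represented

/-! ### Lipschitz functions of represented operators -/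

section Lipschitz

variable {d : ℕ} {O : TopologicalSpace.Opens (Vec d)} {p : ℝ≥0∞} [hp1 : Fact (1 ≤ p)] {T : ℝ}

theorem IsRadonifying.gammaNorm_comp_ne_top {H X Y : Type*} [NormedAddCommGroup H]
    [InnerProductSpace ℝ H] [CompleteSpace H] [NormedAddCommGroup X] [NormedSpace ℝ X]
    [NormedAddCommGroup Y] [NormedSpace ℝ Y] (R : X →L[ℝ] Y) {φ : H →L[ℝ] X}
    (hφ : IsRadonifying φ) : gammaNorm (R.comp φ) ≠ ⊤ :=
  ne_top_of_le_ne_top (ENNReal.mul_ne_top ENNReal.ofReal_ne_top hφ.gammaNorm_ne_top)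
    (gammaNorm_comp_le R φ)

theorem gammaNorm_comp_sub_ne_top {H X Y : Type*} [NormedAddCommGroup H]
    [InnerProductSpace ℝ H] [CompleteSpace H] [NormedAddCommGroup X] [NormedSpace ℝ X]
    [NormedAddCommGroup Y] [NormedSpace ℝ Y] (R : X →L[ℝ] Y) {φ₁ φ₂ : H →L[ℝ] X}
    (h₁ : IsRadonifying φ₁) (h₂ : IsRadonifying φ₂) :
    gammaNorm (R.comp φ₁ - R.comp φ₂) ≠ ⊤ := by
  have e : R.comp φ₁ - R.comp φ₂ = R.comp φ₁ + (-R).comp φ₂ := by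
    rw [ContinuousLinearMap.neg_comp, sub_eq_add_neg]
  rw [e]
  exact ne_top_of_le_ne_top (ENNReal.add_ne_top.2
    ⟨h₁.gammaNorm_comp_ne_top R, h₂.gammaNorm_comp_ne_top (-R)⟩) (gammaNorm_add_le _ _)

theorem continuous_of_abs_sub_le {f : ℝ → Vec d → Mat d → ℝ} {L₁ L₂ L₃ : ℝ≥0}
    (hf : ∀ x y a b A B,
      |f x a A - f y b B| ≤ L₁ * |x - y| + L₂ * ‖a - b‖ + L₃ * ‖A - B‖) :
    Continuous fun z : ℝ × Vec d × Mat d => f z.1 z.2.1 z.2.2 := by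
  refine (LipschitzWith.of_dist_le_mul (K := L₁ + L₂ + L₃) fun z z' => ?_).continuous
  have h1 : |z.1 - z'.1| ≤ dist z z' := le_max_left _ _
  have h2 : ‖z.2.1 - z'.2.1‖ ≤ dist z z' := by
    rw [← dist_eq_norm]
    exact (le_max_left _ _).trans (le_max_right _ _)
  have h3 : ‖z.2.2 - z'.2.2‖ ≤ dist z z' := by
    rw [← dist_eq_norm]
    exact (le_max_right _ _).trans (le_max_right _ _)
  calc _ ≤ _ := hf _ _ _ _ _ _
    _ ≤ L₁ * dist z z' + L₂ * dist z z' + L₃ * dist z z' := by gcongr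
    _ = _ := by
      push_cast
      ring

theorem enorm_sub_le {f : ℝ → Vec d → Mat d → ℝ} {L₁ L₂ L₃ : ℝ≥0}
    (hf : ∀ x y a b A B,
      |f x a A - f y b B| ≤ L₁ * |x - y| + L₂ * ‖a - b‖ + L₃ * ‖A - B‖)
    (x y : ℝ) (a b : Vec d) (A B : Mat d) :
    ‖f x a A - f y b B‖ₑ ≤ L₁ * ‖x - y‖ₑ + L₂ * ‖a - b‖ₑ + L₃ * ‖A - B‖ₑ := by
  have h : ‖f x a A - f y b B‖₊ ≤ L₁ * ‖x - y‖₊ + L₂ * ‖a - b‖₊ + L₃ * ‖A - B‖₊ := by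
    rw [← NNReal.coe_le_coe]
    exact hf x y a b A B
  simp only [enorm_eq_nnnorm]
  exact_mod_cast h

theorem eLpNorm_const_mul_le {α : Type*} [MeasurableSpace α] {μ : Measure α} (q : ℝ≥0∞) (L : ℝ≥0)
    (v : α → ℝ≥0∞) : eLpNorm (fun x => L * v x) q μ ≤ L * eLpNorm v q μ :=
  eLpNorm_le_nnreal_smul_eLpNorm_of_ae_le_mul' (μ := μ) (f := fun x => L * v x) (g := v) (c := L)
    (Filter.Eventually.of_forall fun x => by simp only [enorm_eq_self, le_refl]) q

/-- The triangle inequality in `L^q` for three functions with values in `[0, ∞]`. -/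
theorem eLpNorm_le_of_enorm_le_sum {α E : Type*} [MeasurableSpace α] {μ : Measure α}
    {q : ℝ≥0∞} (hq : 1 ≤ q) [ENorm E] {w : α → E} {w₁ w₂ w₃ : α → ℝ≥0∞} {L₁ L₂ L₃ : ℝ≥0}
    (h₁ : AEMeasurable w₁ μ) (h₂ : AEMeasurable w₂ μ) (h₃ : AEMeasurable w₃ μ)
    (hw : ∀ᵐ x ∂μ, ‖w x‖ₑ ≤ L₁ * w₁ x + L₂ * w₂ x + L₃ * w₃ x) :
    eLpNorm w q μ ≤ L₁ * eLpNorm w₁ q μ + L₂ * eLpNorm w₂ q μ + L₃ * eLpNorm w₃ q μ := by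
  have hm : ∀ (L : ℝ≥0) {v : α → ℝ≥0∞}, AEMeasurable v μ →
      AEStronglyMeasurable (fun x => L * v x) μ := fun L v hv =>
    (hv.const_mul _).aestronglyMeasurable
  calc eLpNorm w q μ
      ≤ eLpNorm ((fun x => L₁ * w₁ x) + (fun x => L₂ * w₂ x) + fun x => L₃ * w₃ x) q μ :=
        eLpNorm_mono_enorm_ae hw
    _ ≤ eLpNorm (fun x => L₁ * w₁ x) q μ + eLpNorm (fun x => L₂ * w₂ x) q μ +
        eLpNorm (fun x => L₃ * w₃ x) q μ :=
        (eLpNorm_add_le ((hm L₁ h₁).add (hm L₂ h₂)) (hm L₃ h₃) hq).trans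
          (add_le_add_left (eLpNorm_add_le (hm L₁ h₁) (hm L₂ h₂) hq) _)
    _ ≤ _ := add_le_add (add_le_add (eLpNorm_const_mul_le q L₁ w₁) (eLpNorm_const_mul_le q L₂ w₂))
        (eLpNorm_const_mul_le q L₃ w₃)

end Lipschitz

end GammaSpace

end

open MeasureTheory GammaSpace in
theorem lemma7p1 (p : ℝ≥0∞) [Fact (1 ≤ p)] (hp : p ≠ ⊤) :
    ∃ C : ℝ≥0, ∀ (d : ℕ) (O : TopologicalSpace.Opens (Vec d)) (T : ℝ), 0 < T →
      (∀ φ : L2Time T →L[ℝ] Sobolev2 O p, IsRadonifying φ →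
        (∃ u, IsRepresentedBy ((toLp O p).comp φ) u) ∧
        (∃ v, IsRepresentedBy ((grad O p).comp φ) v) ∧
        (∃ w, IsRepresentedBy ((hess O p).comp φ) w)) ∧
      ∀ (f : ℝ → Vec d → Mat d → ℝ) (L₁ L₂ L₃ : ℝ≥0),
        (∀ x y a b A B, |f x a A - f y b B| ≤ L₁ * |x - y| + L₂ * ‖a - b‖ + L₃ * ‖A - B‖) →
        ∀ φ₁ φ₂ : L2Time T →L[ℝ] Sobolev2 O p, IsRadonifying φ₁ → IsRadonifying φ₂ →
        ∀ (u₁ u₂ : ℝ → Vec d → ℝ) (v₁ v₂ : ℝ → Vec d → Vec d) (w₁ w₂ : ℝ → Vec d → Mat d),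
          IsRepresentedBy ((toLp O p).comp φ₁) u₁ → IsRepresentedBy ((grad O p).comp φ₁) v₁ →
          IsRepresentedBy ((hess O p).comp φ₁) w₁ →
          IsRepresentedBy ((toLp O p).comp φ₂) u₂ → IsRepresentedBy ((grad O p).comp φ₂) v₂ →
          IsRepresentedBy ((hess O p).comp φ₂) w₂ →
          ∃ S : L2Time T →L[ℝ] LpDom O ℝ p, IsRadonifying S ∧
            IsRepresentedBy S (fun t x => f (u₁ t x) (v₁ t x) (w₁ t x)
              - f (u₂ t x) (v₂ t x) (w₂ t x)) ∧
            gammaNorm S ≤ C * L₁ * gammaNorm ((toLp O p).comp φ₁ - (toLp O p).comp φ₂)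
              + C * L₂ * gammaNorm ((grad O p).comp φ₁ - (grad O p).comp φ₂)
              + C * L₃ * gammaNorm ((hess O p).comp φ₁ - (hess O p).comp φ₂) := by
  have hC : ((upperConst p).toNNReal : ℝ≥0∞) = upperConst p :=
    ENNReal.coe_toNNReal (upperConst_ne_top p)
  refine ⟨(upperConst p).toNNReal * khintchineConst, fun d O T _ => ⟨fun φ hφ =>
    ⟨exists_isRepresentedBy hp (hφ.gammaNorm_comp_ne_top _),
      exists_isRepresentedBy hp (hφ.gammaNorm_comp_ne_top _),
      exists_isRepresentedBy hp (hφ.gammaNorm_comp_ne_top _)⟩, ?_⟩⟩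
  intro f L₁ L₂ L₃ hf φ₁ φ₂ hφ₁ hφ₂ u₁ u₂ v₁ v₂ w₁ w₂ hu₁ hv₁ hw₁ hu₂ hv₂ hw₂
  have hu := hu₁.sub hu₂
  have hv := hv₁.sub hv₂
  have hw := hw₁.sub hw₂
  have hmu := hu.eLpNorm_timeNorm_le hp
  have hmv := hv.eLpNorm_timeNorm_le hp
  have hmw := hw.eLpNorm_timeNorm_le hp
  let g : ℝ → Vec d → ℝ := fun t x =>
    f (u₁ t x) (v₁ t x) (w₁ t x) - f (u₂ t x) (v₂ t x) (w₂ t x)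
  have hfc := continuous_of_abs_sub_le hf
  have hgm : AEStronglyMeasurable (Function.uncurry g)
      ((volume.restrict (Set.Ioo 0 T)).prod (volume.restrict (O : Set (Vec d)))) :=
    (hfc.comp_aestronglyMeasurable (hu₁.aestronglyMeasurable.prodMk
      (hv₁.aestronglyMeasurable.prodMk hw₁.aestronglyMeasurable))).sub
    (hfc.comp_aestronglyMeasurable (hu₂.aestronglyMeasurable.prodMk
      (hv₂.aestronglyMeasurable.prodMk hw₂.aestronglyMeasurable)))
  have hsecm : ∀ᵐ x ∂(volume.restrict (O : Set (Vec d))),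
      AEStronglyMeasurable (fun t => g t x) (volume.restrict (Set.Ioo 0 T)) :=
    hgm.prod_swap.prodMk_left
  have htime : ∀ᵐ x ∂(volume.restrict (O : Set (Vec d))), timeNorm T g x ≤
      L₁ * timeNorm T (fun t x => u₁ t x - u₂ t x) x +
      L₂ * timeNorm T (fun t x => v₁ t x - v₂ t x) x +
      L₃ * timeNorm T (fun t x => w₁ t x - w₂ t x) x := by
    filter_upwards [hu.memLp_section, hv.memLp_section, hw.memLp_section] with x hux hvx hwx
    simp only [timeNorm]
    rw [← eLpNorm_enorm (fun t => u₁ t x - u₂ t x), ← eLpNorm_enorm (fun t => v₁ t x - v₂ t x),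
      ← eLpNorm_enorm (fun t => w₁ t x - w₂ t x)]
    exact eLpNorm_le_of_enorm_le_sum one_le_two hux.aestronglyMeasurable.enorm
      hvx.aestronglyMeasurable.enorm hwx.aestronglyMeasurable.enorm
      (Filter.Eventually.of_forall fun t => enorm_sub_le hf _ _ _ _ _ _)
  have hnorm : eLpNorm (timeNorm T g) p (volume.restrict (O : Set (Vec d))) ≤
      L₁ * (khintchineConst * gammaNorm ((toLp O p).comp φ₁ - (toLp O p).comp φ₂)) +
      L₂ * (khintchineConst * gammaNorm ((grad O p).comp φ₁ - (grad O p).comp φ₂)) +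
      L₃ * (khintchineConst * gammaNorm ((hess O p).comp φ₁ - (hess O p).comp φ₂)) := by
    refine (eLpNorm_le_of_enorm_le_sum Fact.out
      (aemeasurable_timeNorm hu.aestronglyMeasurable)
      (aemeasurable_timeNorm hv.aestronglyMeasurable)
      (aemeasurable_timeNorm hw.aestronglyMeasurable) htime).trans ?_
    gcongr
  have hne : ∀ (L : ℝ≥0) {a : ℝ≥0∞}, a ≠ ⊤ → (L : ℝ≥0∞) * (khintchineConst * a) ≠ ⊤ :=
    fun L a ha => ENNReal.mul_ne_top ENNReal.coe_ne_top (ENNReal.mul_ne_top ENNReal.coe_ne_top ha)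
  have hfin : eLpNorm (timeNorm T g) p (volume.restrict (O : Set (Vec d))) ≠ ⊤ :=
    ne_top_of_le_ne_top (ENNReal.add_ne_top.2 ⟨ENNReal.add_ne_top.2
      ⟨hne L₁ (gammaNorm_comp_sub_ne_top _ hφ₁ hφ₂), hne L₂ (gammaNorm_comp_sub_ne_top _ hφ₁ hφ₂)⟩,
      hne L₃ (gammaNorm_comp_sub_ne_top _ hφ₁ hφ₂)⟩) hnorm
  have hsec : ∀ᵐ x ∂(volume.restrict (O : Set (Vec d))),
      MemLp (fun t => g t x) 2 (volume.restrict (Set.Ioo 0 T)) := by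
    filter_upwards [hsecm, htime, hu.memLp_section, hv.memLp_section, hw.memLp_section]
      with x hx hle hux hvx hwx
    exact ⟨hx, hle.trans_lt (ENNReal.add_lt_top.2 ⟨ENNReal.add_lt_top.2
      ⟨ENNReal.mul_lt_top ENNReal.coe_lt_top hux.2, ENNReal.mul_lt_top ENNReal.coe_lt_top hvx.2⟩,
      ENNReal.mul_lt_top ENNReal.coe_lt_top hwx.2⟩)⟩
  obtain ⟨S, hS⟩ := exists_operator_of_timeNorm hgm hsec hfin
  refine ⟨S, hS.isRadonifying hp hfin, hS, (hS.gammaNorm_le hp).trans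
    ((mul_le_mul_right hnorm _).trans_eq ?_)⟩
  rw [ENNReal.coe_mul, hC]
  ring
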